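/- Let $S=\mathbb{R}^3_+$, let $\theta\in\mathbb{R}^3$, let $\Gamma$ be a symmetric positive definite $3\times 3$ matrix, and let $R$ be a $3\times 3$ matrix with $R_{ii}=1$ for $i=1,2,3$ that is completely-$\mathcal{S}$ (for each principal submatrix $A$ of $R$ there is a vector $w\ge 0$ with $Aw>0$, componentwise). Let $Z$, together with probability measures $\{\mathbb{P}_x : x\in S\}$ on a filtered space $(\Omega,\mathcal{F},\{\mathcal{F}_t\})$, be a semimartingale reflecting Brownian motion (SRBM) with data $(S,\theta,\Gamma,R)$. That is, $Z$ is a continuous $\{\mathcal{F}_t\}$-adapted process and, for each $x\in S$, $\mathbb{P}_x$-almost surely, $Z(t)=X(t)+RY(t)\in S$ for all $t\ge 0$. Here $W(t)=X(t)-\theta t$ is, under $\mathbb{P}_x$, a driftless Brownian motion with covariance matrix $\Gamma$ and an $\{\mathcal{F}_t\}$-martingale with $W(0)=x$ a.s. The process $Y$ is $\{\mathcal{F}_t\}$-adapted and, $\mathbb{P}_x$-a.s., for each $i$ the component $Y_i$ is continuous and nondecreasing with $Y_i(0)=0$ and $\int_0^t 1_{\{Z_i(s)\ne 0\}}\,dY_i(s)=0$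 for all $t\ge 0$. Let $C_1$ be the set of pairs $(\theta,R)$ with $\theta_1,\theta_2,\theta_3<0$ and $$\theta_1>\theta_2R_{12},\quad \theta_3<\theta_2R_{32},\quad \theta_2>\theta_3R_{23},\quad \theta_1<\theta_3R_{13},\quad \theta_3>\theta_1R_{31},\quad \theta_2<\theta_1R_{21},$$ and let $C_2$ be the set of pairs with $\theta_1,\theta_2,\theta_3<0$ that satisfy these six inequalities reversed (fluid paths spiral on the boundary of $S$, counter-clockwise for $C_1$ and clockwise for $C_2$). Let $C=C_1\cup C_2$. Put $$\beta_1(\theta,R)=\frac{\theta_1-\theta_2R_{12}}{\theta_2R_{32}-\theta_3}\cdot\frac{\theta_2-\theta_3R_{23}}{\theta_3R_{13}-\theta_1}\cdot\frac{\theta_3-\theta_1R_{31}}{\theta_1R_{21}-\theta_2},$$ and let the single-cycle gain be $\beta(\theta,R)=\beta_1(\theta,R)$ on $C_1$ and $\beta(\theta,R)=1/\beta_1(\theta,R)$ on $C_2$. **Theorem 3.** If $(\theta,R)\in C$ and $\beta(\theta,R)\ge 1$, then $Z$ is not positive recurrent; that is, it is not the case that $\mathbb{E}_x(\tau_A)<\infty$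 for all $x\in S$ and all open neighborhoods $A$ of the origin, where $\tau_A=\inf\{t\ge 0: Z(t)\in A\}$ and $\inf\emptyset=\infty$. -/

import Mathlib

open MeasureTheory ProbabilityTheory
open scoped NNReal ENNReal Matrix

namespace SRBM

/-- The nonnegative orthant `S = ℝ₊ᵈ`. -/
def orthant (d : ℕ) : Set (Fin d → ℝ) := {x | ∀ i, 0 ≤ x i}

/-- `A` is an `𝒮`-matrix: there is a vector `w ≥ 0` with `A w > 0` (componentwise). -/
def IsSMatrix {ι : Type*} [Fintype ι] (A : Matrix ι ι ℝ) : Prop :=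
  ∃ w : ι → ℝ, (∀ i, 0 ≤ w i) ∧ ∀ i, 0 < (A *ᵥ w) i

/-- `R` is completely-`𝒮`: each of its principal submatrices is an `𝒮`-matrix. -/
def IsCompletelyS {d : ℕ} (R : Matrix (Fin d) (Fin d) ℝ) : Prop :=
  ∀ s : Finset (Fin d), IsSMatrix (R.submatrix (fun i : s => i.1) (fun i : s => i.1))

/-- `W` is, under `P`, a driftless `d`-dimensional Brownian motion with covariance matrix `Γ`
(started from an arbitrary position): independent increments, `W t - W s ∼ N(0, (t - s) Γ)`,
and almost surely continuous paths. -/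
structure IsBrownianMotion {d : ℕ} {Ω : Type*} [MeasurableSpace Ω]
    (Γ : Matrix (Fin d) (Fin d) ℝ) (W : ℝ≥0 → Ω → (Fin d → ℝ)) (P : Measure Ω) : Prop where
  indep : HasIndepIncrements W P
  law : ∀ s t : ℝ≥0, s ≤ t →
    HasLaw (fun ω => WithLp.toLp 2 (W t ω - W s ω))
      (multivariateGaussian 0 (((t : ℝ) - (s : ℝ)) • Γ)) P
  continuous_paths : ∀ᵐ ω ∂P, Continuous fun t => W t ω

/-- The path `y` is continuous and nondecreasing with `y 0 = 0`, and it only increases at times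
when the path `z` vanishes: `∫₀ᵗ 1_{z(s) ≠ 0} dy(s) = 0` for all `t ≥ 0`.  The integral is the
Lebesgue–Stieltjes integral with respect to `y`, extended to negative times by the
constant `y 0`. -/
structure IsRegulator (y z : ℝ≥0 → ℝ) : Prop where
  continuous : Continuous y
  monotone : Monotone y
  zero : y 0 = 0
  complementarity : ∃ f : StieltjesFunction ℝ, (∀ t : ℝ, f t = y t.toNNReal) ∧
    ∀ t : ℝ, 0 ≤ t →
      ∫⁻ s in Set.Icc 0 t, Set.indicator {s : ℝ | z s.toNNReal ≠ 0} 1 s ∂f.measure = 0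

/-- Semimartingale reflecting Brownian motion with data `(S, θ, Γ, R)`, `S = ℝ₊ᵈ`: a continuous
`ℱ`-adapted process `Z` with a family `(P x)`, `x ∈ S`, of probability measures on one filtered
space such that, for each `x ∈ S`, under `P x` one has `Z = X + R Y`, with `Z` in `S`,
where `W t = X t - θ t` is a Brownian motion with covariance matrix `Γ` and an `ℱ`-martingale with
`W 0 = x`, and `Y` is `ℱ`-adapted, continuous and nondecreasing from `0`, its `i`th component
increasing only when `Z i = 0`. -/
structure IsSRBM {d : ℕ} {Ω : Type*} [mΩ : MeasurableSpace Ω]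
    (θ : Fin d → ℝ) (Γ R : Matrix (Fin d) (Fin d) ℝ)
    (ℱ : Filtration ℝ≥0 mΩ) (Z : ℝ≥0 → Ω → (Fin d → ℝ)) (P : orthant d → Measure Ω) :
    Prop where
  continuous : ∀ ω, Continuous fun t => Z t ω
  adapted : StronglyAdapted ℱ Z
  isProbabilityMeasure : ∀ x, IsProbabilityMeasure (P x)
  semimartingale : ∀ x : orthant d, ∃ X Y : ℝ≥0 → Ω → (Fin d → ℝ),
    (∀ᵐ ω ∂P x, ∀ t, Z t ω = X t ω + R *ᵥ Y t ω) ∧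
    (∀ᵐ ω ∂P x, ∀ t, Z t ω ∈ orthant d) ∧
    IsBrownianMotion Γ (fun t ω => X t ω - (t : ℝ) • θ) (P x) ∧
    Martingale (fun t ω => X t ω - (t : ℝ) • θ) ℱ (P x) ∧
    (∀ᵐ ω ∂P x, X 0 ω = x.1) ∧
    StronglyAdapted ℱ Y ∧
    (∀ᵐ ω ∂P x, ∀ i, IsRegulator (fun t => Y t ω i) (fun t => Z t ω i))

/-- `τ_A = inf {t ≥ 0 : Z t ∈ A}`, with `inf ∅ = ∞`. -/
noncomputable def hittingTime {d : ℕ} {Ω : Type*} (Z : ℝ≥0 → Ω → (Fin d → ℝ))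
    (A : Set (Fin d → ℝ)) (ω : Ω) : ℝ≥0∞ :=
  ⨅ (t : ℝ≥0) (_ : Z t ω ∈ A), (t : ℝ≥0∞)

/-- Positive recurrence: `E_x[τ_A] < ∞` for every `x ∈ S` and every open neighbourhood `A` of the
origin. (Asking the same of all closed `A ⊆ S` of positive Lebesgue measure is formally more
restrictive, so the negation of the present property is the stronger negation.) -/
def PositiveRecurrent {d : ℕ} {Ω : Type*} [MeasurableSpace Ω]
    (Z : ℝ≥0 → Ω → (Fin d → ℝ)) (P : orthant d → Measure Ω) : Prop :=
  ∀ x : orthant d, ∀ A : Set (Fin d → ℝ), IsOpen A → 0 ∈ A →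
    ∫⁻ ω, hittingTime Z A ω ∂P x < ∞

/-- Data whose fluid paths spiral counter-clockwise on the boundary (`C₁`).
Coordinates `1, 2, 3` are indexed by `0, 1, 2`. -/
def C₁ : Set ((Fin 3 → ℝ) × Matrix (Fin 3) (Fin 3) ℝ) :=
  {p | let θ := p.1
       let R := p.2
       (∀ i, θ i < 0) ∧
       (θ 0 > θ 1 * R 0 1 ∧ θ 2 < θ 1 * R 2 1) ∧
       (θ 1 > θ 2 * R 1 2 ∧ θ 0 < θ 2 * R 0 2) ∧
       (θ 2 > θ 0 * R 2 0 ∧ θ 1 < θ 0 * R 1 0)}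

/-- Data whose fluid paths spiral clockwise on the boundary (`C₂`): `θ < 0` and the other six
inequalities reversed. -/
def C₂ : Set ((Fin 3 → ℝ) × Matrix (Fin 3) (Fin 3) ℝ) :=
  {p | let θ := p.1
       let R := p.2
       (∀ i, θ i < 0) ∧
       (θ 0 < θ 1 * R 0 1 ∧ θ 2 > θ 1 * R 2 1) ∧
       (θ 1 < θ 2 * R 1 2 ∧ θ 0 > θ 2 * R 0 2) ∧
       (θ 2 < θ 0 * R 2 0 ∧ θ 1 > θ 0 * R 1 0)}

/-- `C = C₁ ∪ C₂`. -/
def C : Set ((Fin 3 → ℝ) × Matrix (Fin 3) (Fin 3) ℝ) := C₁ ∪ C₂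

/-- Single-cycle gain of a counter-clockwise spiral. -/
noncomputable def β₁ (θ : Fin 3 → ℝ) (R : Matrix (Fin 3) (Fin 3) ℝ) : ℝ :=
  ((θ 0 - θ 1 * R 0 1) / (θ 1 * R 2 1 - θ 2)) *
  ((θ 1 - θ 2 * R 1 2) / (θ 2 * R 0 2 - θ 0)) *
  ((θ 2 - θ 0 * R 2 0) / (θ 0 * R 1 0 - θ 1))

/-- Single-cycle gain of a clockwise spiral. -/
noncomputable def β₂ (θ : Fin 3 → ℝ) (R : Matrix (Fin 3) (Fin 3) ℝ) : ℝ :=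
  1 / β₁ θ R

open Classical in
/-- Single-cycle gain for data in `C`: `β₁` on `C₁` and `β₂` on `C₂` (these are disjoint). -/
noncomputable def β (θ : Fin 3 → ℝ) (R : Matrix (Fin 3) (Fin 3) ℝ) : ℝ :=
  if (θ, R) ∈ C₁ then β₁ θ R else β₂ θ R

end SRBM

/-! On the face where coordinate `j` vanishes, a fluid path has pushing rate `-θ j`, because the
diagonal of `R` is one. A gain of at least one makes three cyclic inequalities solvable, which
yields weights `u > 0` such that `u ⬝ᵥ z` does not decrease along fluid paths on any of the three
faces (`exists_spiral`). For the reflected process, replace `u` by the functions `c a = u - l p e_p`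
with `p = q a`, where `l p` is chosen so that the drift of `c a ⬝ᵥ Z` vanishes. Every pushing
direction except that of coordinate `q (a + 1)` then increases `c a ⬝ᵥ Z`. While this coordinate is
positive, the increments of `c a ⬝ᵥ Z` dominate those of the martingale `c a ⬝ᵥ W`. When it falls to
a level `η` on a time grid, the phase advances, and the change of function costs at most a constant
times `η`. Outside a ball around the origin the coordinates are never all small. By uniform
continuity, the number of phase changes before the ball is hit is bounded for each path,
independently of `η` and the mesh, so the total cost tends to zero. Hence the stopped martingale sum
ends at or below some `-δ < 0` on fine grids (`gain_le`): it is at most a small terminal value,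
minus a larger initial value, plus this cost. If the hitting time had finite mean, this sum would be
centred with a second moment bounded uniformly in `η` and the mesh (`integral_gain`,
`integral_gain_sq_le`). It would then exceed `-δ` with probability bounded below
(`le_measure_of_integral_eq_zero`), a contradiction. -/

namespace SRBM

/-! ### Discrete stochastic integrals against a martingale. -/

section MartingaleTransform

variable {Ω : Type*} {mΩ : MeasurableSpace Ω} {P : Measure Ω}

theorem integral_mul_eq_zero_of_condExp_eq_zero [IsFiniteMeasure P] {m : MeasurableSpace Ω}
    (hm : m ≤ mΩ) {U D : Ω → ℝ} (hU : StronglyMeasurable[m] U) (hU2 : MemLp U 2 P)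
    (hD2 : MemLp D 2 P) (hD : P[D|m] =ᵐ[P] 0) : ∫ ω, U ω * D ω ∂P = 0 := by
  have h1 : Integrable (U * D) P := hU2.integrable_mul hD2
  have h2 := condExp_mul_of_stronglyMeasurable_left hU h1 (hD2.integrable (by norm_num))
  have h3 : ∫ ω, (P[U * D|m]) ω ∂P = ∫ ω, (U * D) ω ∂P := integral_condExp hm
  have h4 : ∫ ω, (P[U * D|m]) ω ∂P = 0 := by
    rw [integral_congr_ae (g := fun _ => (0 : ℝ))]
    · simp
    · filter_upwards [h2, hD] with ω h h'
      rw [h, Pi.mul_apply, h']; simp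
  rw [h4] at h3
  exact h3.symm

theorem memLp_two_mul_of_bounded {H D : Ω → ℝ} {c : ℝ} (hH : AEStronglyMeasurable H P)
    (hHc : ∀ ω, |H ω| ≤ c) (hD : MemLp D 2 P) : MemLp (fun ω => H ω * D ω) 2 P := by
  refine (hD.const_mul c).mono (hH.mul hD.1) (ae_of_all _ fun ω => ?_)
  rw [norm_mul, norm_mul]
  gcongr
  exact (hHc ω).trans (le_abs_self c)

/-- The discrete stochastic integral `∑ H k (B (t (k+1)) - B (t k))`. -/
def transform (B : ℝ≥0 → Ω → ℝ) (t : ℕ → ℝ≥0) (H : ℕ → Ω → ℝ) (n : ℕ) (ω : Ω) : ℝ :=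
  ∑ k ∈ Finset.range n, H k ω * (B (t (k + 1)) ω - B (t k) ω)

theorem condExp_increment [IsFiniteMeasure P] {ℱ : Filtration ℝ≥0 mΩ} {B : ℝ≥0 → Ω → ℝ}
    (hB : Martingale B ℱ P) {s t : ℝ≥0} (hst : s ≤ t) :
    P[fun ω => B t ω - B s ω|ℱ s] =ᵐ[P] 0 := by
  have h1 := condExp_sub (hB.integrable t) (hB.integrable s) (ℱ s)
  have h2 := hB.2 s t hst
  have h3 := hB.2 s s le_rfl
  change P[B t - B s|ℱ s] =ᵐ[P] 0
  filter_upwards [h1, h2, h3] with ω a b c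
  rw [a, Pi.sub_apply, b, c]; simp

variable {ℱ : Filtration ℝ≥0 mΩ} {B : ℝ≥0 → Ω → ℝ} {t : ℕ → ℝ≥0} {H : ℕ → Ω → ℝ} {c : ℝ}

theorem stronglyMeasurable_transform (hB : Martingale B ℱ P) (ht : Monotone t)
    (hH : ∀ k, StronglyMeasurable[ℱ (t k)] (H k)) (n : ℕ) :
    StronglyMeasurable[ℱ (t n)] (transform B t H n) := by
  refine Finset.stronglyMeasurable_fun_sum _ fun k hk => ?_
  have hk' : k + 1 ≤ n := Finset.mem_range.1 hk
  refine StronglyMeasurable.mul ((hH k).mono (ℱ.mono (ht (by omega)))) (StronglyMeasurable.sub ?_ ?_)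
  · exact (hB.1 _).mono (ℱ.mono (ht hk'))
  · exact (hB.1 _).mono (ℱ.mono (ht (by omega)))

theorem memLp_transform (hB2 : ∀ s t, s ≤ t → MemLp (fun ω => B t ω - B s ω) 2 P)
    (ht : Monotone t)
    (hH : ∀ k, StronglyMeasurable[ℱ (t k)] (H k)) (hHc : ∀ k ω, |H k ω| ≤ c) (n : ℕ) :
    MemLp (transform B t H n) 2 P := by
  refine memLp_finsetSum _ fun k _ => ?_
  exact memLp_two_mul_of_bounded ((hH k).mono (ℱ.le _)).aestronglyMeasurable (hHc k)
    (hB2 _ _ (ht (Nat.le_succ k)))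

theorem integral_transform [IsFiniteMeasure P] (hB : Martingale B ℱ P)
    (hB2 : ∀ s t, s ≤ t → MemLp (fun ω => B t ω - B s ω) 2 P) (ht : Monotone t)
    (hH : ∀ k, StronglyMeasurable[ℱ (t k)] (H k)) (hHc : ∀ k ω, |H k ω| ≤ c) (n : ℕ) :
    ∫ ω, transform B t H n ω ∂P = 0 := by
  unfold transform
  rw [integral_finsetSum]
  · refine Finset.sum_eq_zero fun k _ => ?_
    refine integral_mul_eq_zero_of_condExp_eq_zero (ℱ.le (t k)) (hH k) ?_
      (hB2 _ _ (ht (Nat.le_succ k))) (condExp_increment hB (ht (Nat.le_succ k)))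
    exact MemLp.of_bound ((hH k).mono (ℱ.le _)).aestronglyMeasurable c (ae_of_all _ (hHc k))
  · intro k _
    exact (memLp_two_mul_of_bounded ((hH k).mono (ℱ.le _)).aestronglyMeasurable (hHc k)
      (hB2 _ _ (ht (Nat.le_succ k)))).integrable (by norm_num)

theorem integral_transform_sq [IsFiniteMeasure P] (hB : Martingale B ℱ P)
    (hB2 : ∀ s t, s ≤ t → MemLp (fun ω => B t ω - B s ω) 2 P) (ht : Monotone t)
    (hH : ∀ k, StronglyMeasurable[ℱ (t k)] (H k)) (hHc : ∀ k ω, |H k ω| ≤ c) (n : ℕ) :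
    ∫ ω, transform B t H n ω ^ 2 ∂P =
      ∑ k ∈ Finset.range n, ∫ ω, (H k ω * (B (t (k + 1)) ω - B (t k) ω)) ^ 2 ∂P := by
  induction n with
  | zero => simp [transform]
  | succ n ih =>
    rw [Finset.sum_range_succ, ← ih]
    have hS := memLp_transform hB2 ht hH hHc n
    have hSm := stronglyMeasurable_transform hB ht hH n
    have hD := hB2 _ _ (ht (Nat.le_succ n))
    have hHm : AEStronglyMeasurable (H n) P := ((hH n).mono (ℱ.le _)).aestronglyMeasurable
    have hHD := memLp_two_mul_of_bounded hHm (hHc n) hD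
    -- Orthogonality of martingale differences: the past sum times `H n` is known at time `t n`.
    have hcross : ∫ ω, (transform B t H n ω * H n ω) * (B (t (n + 1)) ω - B (t n) ω) ∂P = 0 := by
      refine integral_mul_eq_zero_of_condExp_eq_zero (ℱ.le (t n)) (hSm.mul (hH n)) ?_ hD
        (condExp_increment hB (ht (Nat.le_succ n)))
      have := memLp_two_mul_of_bounded hHm (hHc n) hS
      simpa only [mul_comm] using this
    have e : ∀ ω, transform B t H (n + 1) ω ^ 2 = transform B t H n ω ^ 2 +
        (2 * ((transform B t H n ω * H n ω) * (B (t (n + 1)) ω - B (t n) ω)) +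
        (H n ω * (B (t (n + 1)) ω - B (t n) ω)) ^ 2) := by
      intro ω
      simp only [transform, Finset.sum_range_succ]
      ring
    simp_rw [e]
    have hi : Integrable
        (fun ω => (transform B t H n ω * H n ω) * (B (t (n + 1)) ω - B (t n) ω)) P := by
      have := hS.integrable_mul hHD
      refine this.congr (ae_of_all _ fun ω => ?_)
      simp only [Pi.mul_apply]; ring
    have hq : Integrable (fun ω => (H n ω * (B (t (n + 1)) ω - B (t n) ω)) ^ 2) P :=
      hHD.integrable_sq
    have hi2 : Integrable (fun ω => 2 * ((transform B t H n ω * H n ω) *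
        (B (t (n + 1)) ω - B (t n) ω))) P := hi.const_mul 2
    have hsum : Integrable (fun ω => 2 * ((transform B t H n ω * H n ω) *
        (B (t (n + 1)) ω - B (t n) ω)) + (H n ω * (B (t (n + 1)) ω - B (t n) ω)) ^ 2) P :=
      hi2.add hq
    rw [integral_add hS.integrable_sq hsum, integral_add hi2 hq, integral_const_mul, hcross]
    simp

end MartingaleTransform

end SRBM

namespace SRBM

/-! ### Second moments of Brownian increments on events of the filtration. -/

section ScalarBrownian

variable {Ω : Type*} {mΩ : MeasurableSpace Ω} {P : Measure Ω}

/-- `B` is a real Brownian motion with variance parameter `g` and an `ℱ`-martingale. -/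
structure IsScalarBM (g : ℝ≥0) (ℱ : Filtration ℝ≥0 mΩ) (B : ℝ≥0 → Ω → ℝ) (P : Measure Ω) :
    Prop where
  martingale : Martingale B ℱ P
  indep : HasIndepIncrements B P
  law : ∀ s t : ℝ≥0, s ≤ t →
    HasLaw (fun ω => B t ω - B s ω) (gaussianReal 0 ((t - s) * g)) P

theorem memLp_sq_gaussianReal (v : ℝ≥0) : MemLp (fun x : ℝ => x ^ 2) 2 (gaussianReal 0 v) := by
  rw [memLp_two_iff_integrable_sq (by fun_prop)]
  have h := (memLp_id_gaussianReal (μ := 0) (v := v) 4).integrable_norm_pow (by norm_num)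
  refine h.congr (ae_of_all _ fun x => ?_)
  simp only [id, Real.norm_eq_abs]
  rw [← pow_mul, (show Even 4 by decide).pow_abs]

/-- Brownian scaling. The factor `h ^ 2` makes the variance of a sum of squared increments over `n`
cells of length `1 / n` of order `1 / n`. -/
theorem variance_sq_gaussianReal (h g : ℝ≥0) :
    Var[fun x => x ^ 2; gaussianReal 0 (h * g)] =
      (h : ℝ) ^ 2 * Var[fun x => x ^ 2; gaussianReal 0 g] := by
  have h1 : gaussianReal 0 (h * g) = (gaussianReal 0 g).map (fun x => √h * x) := by
    rw [gaussianReal_map_const_mul]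
    congr 1
    · simp
    · congr 1
      ext
      simp
  rw [h1, variance_map (by fun_prop) (by fun_prop), ← variance_const_mul]
  congr 1
  ext x
  simp [mul_pow]

variable {g : ℝ≥0} {ℱ : Filtration ℝ≥0 mΩ} {B : ℝ≥0 → Ω → ℝ}

theorem IsScalarBM.memLp_sq (hB : IsScalarBM g ℱ B P) {s t : ℝ≥0} (hst : s ≤ t) :
    MemLp (fun ω => (B t ω - B s ω) ^ 2) 2 P := by
  have h := memLp_sq_gaussianReal ((t - s) * g)
  rw [← (hB.law s t hst).map_eq] at h
  exact h.comp_of_map (hB.law s t hst).aemeasurable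

theorem IsScalarBM.memLp (hB : IsScalarBM g ℱ B P) {s t : ℝ≥0} (hst : s ≤ t) :
    MemLp (fun ω => B t ω - B s ω) 2 P := by
  have h := memLp_id_gaussianReal (μ := 0) (v := (t - s) * g) 2
  rw [← (hB.law s t hst).map_eq] at h
  exact h.comp_of_map (hB.law s t hst).aemeasurable

theorem IsScalarBM.integral_sq (hB : IsScalarBM g ℱ B P) {s t : ℝ≥0} (hst : s ≤ t) :
    ∫ ω, (B t ω - B s ω) ^ 2 ∂P = ((t - s) * g : ℝ≥0) := by
  have h1 := (hB.law s t hst).integral_comp (f := fun x : ℝ => x ^ 2) (by fun_prop)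
  have h2 : ∫ x, x ^ 2 ∂gaussianReal 0 ((t - s) * g) = ((t - s) * g : ℝ≥0) := by
    rw [← variance_fun_id_gaussianReal (μ := 0) (v := (t - s) * g),
      variance_of_integral_eq_zero (by fun_prop) (by simp)]
  rw [← h2, ← h1]
  rfl

theorem IsScalarBM.variance_sq (hB : IsScalarBM g ℱ B P) {s t : ℝ≥0} (hst : s ≤ t) :
    Var[fun ω => (B t ω - B s ω) ^ 2; P] =
      ((t - s : ℝ≥0) : ℝ) ^ 2 * Var[fun x => x ^ 2; gaussianReal 0 g] := by
  rw [← variance_sq_gaussianReal, ← (hB.law s t hst).map_eq,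
    variance_map (by fun_prop) (hB.law s t hst).aemeasurable]
  rfl

theorem le_add_sq_div {ε : ℝ} (hε : 0 < ε) (y : ℝ) : |y| ≤ ε + y ^ 2 / ε := by
  rw [← sub_le_iff_le_add', le_div_iff₀ hε, ← sq_abs]
  nlinarith [sq_nonneg (|y| - ε), abs_nonneg y]

/-- The quadratic variation of a Brownian martingale determines the second moment of its
increments conditionally on the filtration. -/
theorem IsScalarBM.setIntegral_sq_le [IsProbabilityMeasure P] (hB : IsScalarBM g ℱ B P)
    {s t : ℝ≥0} (hst : s ≤ t) {A : Set Ω} (hA : MeasurableSet[ℱ s] A) :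
    ∫ ω in A, (B t ω - B s ω) ^ 2 ∂P ≤ (t - s) * g * P.real A := by
  have hA' : MeasurableSet A := ℱ.le s A hA
  set K := Var[fun x => x ^ 2; gaussianReal 0 g] with hK
  -- Increments are independent of each other, but are not assumed independent of `ℱ s`. The
  -- martingale property replaces the squared increment on `A` by the sum `Q` of squares over `n +
  -- 1` cells. Independence concentrates `Q` at `(t - s) * g`, so restricting to `A` costs only an
  -- `L¹` error.
  have key : ∀ ε : ℝ, 0 < ε → ∀ n : ℕ, ∫ ω in A, (B t ω - B s ω) ^ 2 ∂P ≤
      (t - s) * g * P.real A + (ε + (t - s) ^ 2 * K / ε * (1 / ((n : ℝ) + 1))) := by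
    intro ε hε n
    set h : ℝ≥0 := (t - s) / (n + 1) with hh
    set r : ℕ → ℝ≥0 := fun i => s + i * h with hr
    have hnh : ((n : ℝ) + 1) * h = t - s := by
      rw [hh]; push_cast [NNReal.coe_sub hst]; field_simp
    have hrmono : Monotone r := by
      intro i j hij; simp only [hr]; gcongr
    have hrs : ∀ i, r (i + 1) - r i = h := by
      intro i
      apply tsub_eq_of_eq_add
      simp only [hr]; push_cast; ring
    have hr0 : r 0 = s := by simp [hr]
    have hrn : r (n + 1) = t := by
      apply NNReal.eq
      simp only [hr]; push_cast; rw [hnh]; ring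
    set H : ℕ → Ω → ℝ := fun _ => A.indicator 1 with hH
    have hHm : ∀ k, StronglyMeasurable[ℱ (r k)] (H k) := by
      intro k
      exact (stronglyMeasurable_one.indicator hA).mono (ℱ.mono (le_self_add : s ≤ s + k * h))
    have hHc : ∀ k ω, |H k ω| ≤ 1 := by
      intro k ω
      simp only [hH, Set.indicator]; split_ifs <;> simp
    have h1 := integral_transform_sq hB.martingale (fun s t hst => hB.memLp hst) hrmono hHm hHc
      (n + 1)
    have h2 : ∀ ω, transform B r H (n + 1) ω ^ 2 =
        A.indicator (fun ω => (B t ω - B s ω) ^ 2) ω := by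
      intro ω
      simp only [transform, hH]
      rw [← Finset.mul_sum, Finset.sum_range_sub (fun k => B (r k) ω), hr0, hrn]
      by_cases hω : ω ∈ A <;> simp [hω]
    have h3 : ∀ k ω, (H k ω * (B (r (k + 1)) ω - B (r k) ω)) ^ 2 =
        A.indicator (fun ω => (B (r (k + 1)) ω - B (r k) ω) ^ 2) ω := by
      intro k ω
      by_cases hω : ω ∈ A <;> simp [hω, hH]
    simp_rw [h2, h3, integral_indicator hA'] at h1
    have hX2 : ∀ k, MemLp (fun ω => (B (r (k + 1)) ω - B (r k) ω) ^ 2) 2 P :=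
      fun k => hB.memLp_sq (hrmono (Nat.le_succ k))
    have hXi : ∀ k, Integrable (fun ω => (B (r (k + 1)) ω - B (r k) ω) ^ 2) P :=
      fun k => (hX2 k).integrable (by norm_num)
    set Q : Ω → ℝ := ∑ k ∈ Finset.range (n + 1), fun ω => (B (r (k + 1)) ω - B (r k) ω) ^ 2 with hQ
    have hQ2 : MemLp Q 2 P := memLp_finsetSum' _ fun k _ => hX2 k
    have hQA : ∑ k ∈ Finset.range (n + 1), ∫ ω in A, (B (r (k + 1)) ω - B (r k) ω) ^ 2 ∂P =
        ∫ ω in A, Q ω ∂P := by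
      rw [← integral_finsetSum _ fun k _ => (hXi k).integrableOn]
      simp [hQ]
    have hEQ : ∫ ω, Q ω ∂P = (t - s) * g := by
      simp only [hQ, Finset.sum_apply]
      rw [integral_finsetSum _ fun k _ => hXi k]
      rw [Finset.sum_congr rfl fun k _ => hB.integral_sq (hrmono (Nat.le_succ k))]
      simp only [Nat.succ_eq_add_one, hrs]
      rw [← hnh]; simp; ring
    have hVar : Var[Q; P] = (t - s) ^ 2 * K * (1 / ((n : ℝ) + 1)) := by
      rw [hQ, IndepFun.variance_sum (fun k _ => hX2 k)]
      · rw [Finset.sum_congr rfl fun k _ => hB.variance_sq (hrmono (Nat.le_succ k))]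
        simp only [Nat.succ_eq_add_one, hrs]
        rw [← hnh, ← hK]; simp; field_simp
      · intro i _ j _ hij
        exact ((hB.indep.nat hrmono).indepFun hij).comp (φ := fun x => x ^ 2)
          (ψ := fun x => x ^ 2) (by fun_prop) (by fun_prop)
    have hc : Integrable (fun ω => Q ω - (t - s) * g) P :=
      (hQ2.integrable (by norm_num)).sub (integrable_const _)
    have hc2 : Integrable (fun ω => (Q ω - (t - s) * g) ^ 2) P :=
      (hQ2.sub (memLp_const _)).integrable_sq
    have h4 : ∫ ω in A, (Q ω - (t - s) * g) ∂P ≤ ε + Var[Q; P] / ε := by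
      calc ∫ ω in A, (Q ω - (t - s) * g) ∂P ≤ ∫ ω in A, |Q ω - (t - s) * g| ∂P :=
            integral_mono hc.integrableOn hc.abs.integrableOn fun ω => le_abs_self _
        _ ≤ ∫ ω, |Q ω - (t - s) * g| ∂P :=
            setIntegral_le_integral hc.abs (ae_of_all _ fun ω => abs_nonneg _)
        _ ≤ ∫ ω, (ε + (Q ω - (t - s) * g) ^ 2 / ε) ∂P :=
            integral_mono hc.abs ((integrable_const _).add (hc2.div_const ε))
              fun ω => le_add_sq_div hε _
        _ = ε + Var[Q; P] / ε := by
            rw [integral_add (integrable_const _) (hc2.div_const ε), integral_div,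
              variance_eq_integral hQ2.1.aemeasurable, hEQ]
            simp
    have h5 : ∫ ω in A, (Q ω - (t - s) * g) ∂P =
        ∫ ω in A, Q ω ∂P - (t - s) * g * P.real A := by
      rw [integral_sub (hQ2.integrable (by norm_num)).integrableOn (integrable_const _)]
      simp [mul_comm]
    rw [h1, hQA]
    rw [hVar] at h4
    have : (t - s : ℝ) ^ 2 * K * (1 / ((n : ℝ) + 1)) / ε =
      (t - s) ^ 2 * K / ε * (1 / ((n : ℝ) + 1)) := by ring
    linarith
  -- The number of cells tends to infinity for fixed `ε`; then `ε` is arbitrary.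
  refine le_of_forall_pos_le_add fun ε hε => ?_
  have hlim : Filter.Tendsto (fun n : ℕ => ((t : ℝ) - s) * g * P.real A +
      (ε + (t - s) ^ 2 * K / ε * (1 / ((n : ℝ) + 1)))) Filter.atTop
      (nhds ((t - s) * g * P.real A + (ε + (t - s) ^ 2 * K / ε * 0))) :=
    ((tendsto_one_div_add_atTop_nhds_zero_nat.const_mul _).const_add _).const_add _
  have := ge_of_tendsto' hlim (key ε hε)
  simpa using this

end ScalarBrownian

end SRBM

/-! ### Phases and the pathwise inequality along a grid. -/

namespace SRBM

/-- One update of the phase `a`: advance until the component `q (a + 1)` of `z` exceeds `η`,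
by at most two steps. -/
noncomputable def phaseStep (q : ℕ → Fin 3) (η : ℝ) (z : Fin 3 → ℝ) (a : ℕ) : ℕ :=
  if η < z (q (a + 1)) then a else if η < z (q (a + 2)) then a + 1 else a + 2

/-- The phase along the sequence of positions `z`. -/
noncomputable def phase (q : ℕ → Fin 3) (η : ℝ) (z : ℕ → Fin 3 → ℝ) : ℕ → ℕ
  | 0 => 0
  | k + 1 => phaseStep q η (z (k + 1)) (phase q η z k)

/-- The path `z` stays outside `A` up to time `t`. -/
def Avoids (A : Set (Fin 3 → ℝ)) (z : ℝ≥0 → Fin 3 → ℝ) (t : ℝ≥0) : Prop := ∀ r ≤ t, z r ∉ A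

/-- Data of a spiral: an enumeration `q` of the coordinates in the order in which the faces are
visited, and linear functions `c p = u - l p e_p` without drift for which only the component
`q (a + 1)` of the regulator may be harmful in the phase `a`. -/
structure Spiral (θ : Fin 3 → ℝ) (R : Matrix (Fin 3) (Fin 3) ℝ) where
  q : ℕ → Fin 3
  u : Fin 3 → ℝ
  l : Fin 3 → ℝ
  q_cover : ∀ a j, j = q (a + 1) ∨ j = q (a + 2) ∨ j = q a
  q_period : ∀ a, q (a + 3) = q a
  q_ne : q 0 ≠ q 1
  u_pos : ∀ i, 0 < u i
  l_pos : ∀ i, 0 < l i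
  drift : ∀ p, (u - Pi.single p (l p)) ⬝ᵥ θ = 0
  reflection : ∀ a j, j ≠ q (a + 1) → 0 ≤ ((u - Pi.single (q a) (l (q a))) ᵥ* R) j

namespace Spiral

variable {θ : Fin 3 → ℝ} {R : Matrix (Fin 3) (Fin 3) ℝ} (S : Spiral θ R)

/-- The linear function used in the phase `a`. -/
def c (a : ℕ) : Fin 3 → ℝ := S.u - Pi.single (S.q a) (S.l (S.q a))

/-- An upper bound of the coefficients `l`. -/
def bound : ℝ := ∑ i, S.l i

theorem l_le_bound (p : Fin 3) : S.l p ≤ S.bound :=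
  Finset.single_le_sum (fun i _ => (S.l_pos i).le) (Finset.mem_univ p)

theorem bound_pos : 0 < S.bound := (S.l_pos 0).trans_le (S.l_le_bound 0)

theorem c_dotProduct (a : ℕ) (z : Fin 3 → ℝ) :
    S.c a ⬝ᵥ z = S.u ⬝ᵥ z - S.l (S.q a) * z (S.q a) := by
  rw [c, sub_dotProduct, single_dotProduct]

/-- The path decomposition of a reflected path in the orthant. -/
structure IsReflected (θ : Fin 3 → ℝ) (R : Matrix (Fin 3) (Fin 3) ℝ)
    (z w y : ℝ≥0 → Fin 3 → ℝ) : Prop where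
  eq : ∀ t, z t = w t + (t : ℝ) • θ + R *ᵥ y t
  nonneg : ∀ t i, 0 ≤ z t i
  regulator : ∀ i, IsRegulator (fun t => y t i) (fun t => z t i)

end Spiral

theorem IsRegulator.eq_of_pos {y z : ℝ≥0 → ℝ} (h : IsRegulator y z) {s t : ℝ≥0} (hst : s ≤ t)
    (hz : ∀ r, s ≤ r → r ≤ t → 0 < z r) : y t = y s := by
  obtain ⟨f, hf, hc⟩ := h.complementarity
  have h1 := hc t t.2
  have h2 : f.measure (Set.Ioc (s : ℝ) t) = 0 := by
    refine le_antisymm ?_ zero_le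
    rw [← h1, ← setLIntegral_one]
    calc ∫⁻ x in Set.Ioc (s : ℝ) t, 1 ∂f.measure
        = ∫⁻ x in Set.Ioc (s : ℝ) t, Set.indicator {x : ℝ | z x.toNNReal ≠ 0} 1 x ∂f.measure := by
          refine setLIntegral_congr_fun measurableSet_Ioc fun x hx => ?_
          have hx0 : (0 : ℝ) ≤ x := s.2.trans hx.1.le
          have : 0 < z x.toNNReal := by
            refine hz _ ?_ ?_
            · rw [← NNReal.coe_le_coe, Real.coe_toNNReal _ hx0]; exact hx.1.le
            · rw [← NNReal.coe_le_coe, Real.coe_toNNReal _ hx0]; exact hx.2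
          simp [Set.indicator, this.ne']
      _ ≤ _ := by
          refine lintegral_mono_set fun x hx => ⟨s.2.trans hx.1.le, hx.2⟩
  rw [StieltjesFunction.measure_Ioc, ENNReal.ofReal_eq_zero, hf, hf] at h2
  simp only [Real.toNNReal_coe] at h2
  exact le_antisymm (by linarith) (h.monotone hst)

namespace Spiral

variable {θ : Fin 3 → ℝ} {R : Matrix (Fin 3) (Fin 3) ℝ} (S : Spiral θ R)
  {z w y : ℝ≥0 → Fin 3 → ℝ}

/-- The drift is annihilated by `c a`. The regulator of coordinate `q (a + 1)` is frozen while that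
coordinate is positive, and the other regulators enter with nonnegative coefficients. -/
theorem increment_le (h : IsReflected θ R z w y) {s t : ℝ≥0} (hst : s ≤ t) (a : ℕ)
    (hz : ∀ r, s ≤ r → r ≤ t → 0 < z r (S.q (a + 1))) :
    S.c a ⬝ᵥ (w t - w s) ≤ S.c a ⬝ᵥ z t - S.c a ⬝ᵥ z s := by
  have hd : S.c a ⬝ᵥ θ = 0 := S.drift (S.q a)
  have e : ∀ t, S.c a ⬝ᵥ z t = S.c a ⬝ᵥ w t + (S.c a ᵥ* R) ⬝ᵥ y t := by
    intro t
    rw [h.eq t, dotProduct_add, dotProduct_add, dotProduct_smul, hd, Matrix.dotProduct_mulVec]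
    simp
  rw [e, e, dotProduct_sub]
  have : 0 ≤ (S.c a ᵥ* R) ⬝ᵥ (y t - y s) := by
    refine Finset.sum_nonneg fun j _ => ?_
    by_cases hj : j = S.q (a + 1)
    · have : y t j = y s j := (h.regulator j).eq_of_pos hst (by rw [hj]; exact hz)
      simp [this]
    · refine mul_nonneg (S.reflection a j hj) (sub_nonneg.2 ((h.regulator j).monotone hst))
  rw [dotProduct_sub] at this
  linarith

theorem le_phaseStep (η : ℝ) (x : Fin 3 → ℝ) (a : ℕ) : a ≤ phaseStep S.q η x a := by
  unfold phaseStep; split_ifs <;> omega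

theorem le_of_lt_phaseStep {η : ℝ} {x : Fin 3 → ℝ} {a b : ℕ} (h1 : a < b)
    (h2 : b ≤ phaseStep S.q η x a) : x (S.q b) ≤ η := by
  unfold phaseStep at h2
  split_ifs at h2 with h3 h4
  · omega
  · obtain rfl : b = a + 1 := by omega
    exact not_lt.1 h3
  · obtain rfl | rfl : b = a + 1 ∨ b = a + 2 := by omega
    · exact not_lt.1 h3
    · exact not_lt.1 h4

theorem lt_phaseStep_next {η : ℝ} {x : Fin 3 → ℝ} (hx : ∃ i, η < x i) (a : ℕ) :
    η < x (S.q (phaseStep S.q η x a + 1)) := by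
  unfold phaseStep
  split_ifs with h1 h2
  · exact h1
  · exact h2
  -- In the default case, the coordinates `q (a + 1)` and `q (a + 2)` are both at most `η`, so the
  -- large one must be `q a = q (a + 3)`.
  · rw [show a + 2 + 1 = a + 3 from rfl, S.q_period]
    obtain ⟨i, hi⟩ := hx
    rcases S.q_cover a i with rfl | rfl | rfl
    · exact absurd hi h1
    · exact absurd hi h2
    · exact hi

/-- The old function is at most `u ⬝ᵥ x`. The new one subtracts only a multiple of the coordinate `q
b` of the new phase `b`, which is at most `η` at the moment of the switch. -/
theorem phase_change {η : ℝ} (hη : 0 ≤ η) {x : Fin 3 → ℝ} (hx : ∀ i, 0 ≤ x i) (a : ℕ) :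
    S.c a ⬝ᵥ x + S.bound * η * a ≤
      S.c (phaseStep S.q η x a) ⬝ᵥ x + S.bound * η * (phaseStep S.q η x a : ℕ) := by
  rcases (S.le_phaseStep η x a).eq_or_lt with h | h
  · rw [← h]
  · have h1 := S.le_of_lt_phaseStep h le_rfl
    rw [c_dotProduct, c_dotProduct]
    set b := phaseStep S.q η x a
    have h2 : (a : ℝ) + 1 ≤ b := by exact_mod_cast h
    have h3 : S.l (S.q b) * x (S.q b) ≤ S.bound * η :=
      mul_le_mul (S.l_le_bound _) h1 (hx _) S.bound_pos.le
    have h4 : 0 ≤ S.l (S.q a) * x (S.q a) := mul_nonneg (S.l_pos _).le (hx _)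
    have h5 : 0 ≤ S.bound * η := mul_nonneg S.bound_pos.le hη
    nlinarith

theorem exists_le_of_lt_phase {η : ℝ} {x : ℕ → Fin 3 → ℝ} {l k : ℕ} (hlk : l ≤ k) {b : ℕ}
    (h1 : phase S.q η x l < b) (h2 : b ≤ phase S.q η x k) :
    ∃ i, l < i ∧ i ≤ k ∧ x i (S.q b) ≤ η := by
  induction k, hlk using Nat.le_induction with
  | base => omega
  | succ k hk ih =>
    by_cases h : b ≤ phase S.q η x k
    · obtain ⟨i, hi1, hi2, hi3⟩ := ih h
      exact ⟨i, hi1, by omega, hi3⟩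
    · exact ⟨k + 1, by omega, le_rfl, S.le_of_lt_phaseStep (not_le.1 h) h2⟩

/-- Between two grid times over which a path outside the ball of radius `ε` varies little, the
phase advances by at most two. -/
theorem phase_le_add_two {η ε : ℝ} {x : ℕ → Fin 3 → ℝ} {l k : ℕ} (hlk : l ≤ k)
    (hx : ∃ i, ε ≤ x l i) (hη : η ≤ ε / 2)
    (hosc : ∀ i, l ≤ i → i ≤ k → ∀ j, |x i j - x l j| < ε / 2) :
    phase S.q η x k ≤ phase S.q η x l + 2 := by
  by_contra! h
  obtain ⟨j, hj⟩ := hx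
  -- Three advances run through all coordinates, including the one that starts above `ε`; it would
  -- have to fall to `η ≤ ε / 2` within the window.
  have : ∃ b, phase S.q η x l < b ∧ b ≤ phase S.q η x k ∧ j = S.q b := by
    rcases S.q_cover (phase S.q η x l) j with h' | h' | h'
    · exact ⟨_, by omega, by omega, h'⟩
    · exact ⟨_, by omega, by omega, h'⟩
    · exact ⟨phase S.q η x l + 3, by omega, by omega, by rw [S.q_period]; exact h'⟩
  obtain ⟨b, hb1, hb2, hb3⟩ := this
  obtain ⟨i, hi1, hi2, hi3⟩ := S.exists_le_of_lt_phase hlk hb1 hb2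
  have := hosc i hi1.le hi2 j
  rw [abs_lt] at this
  rw [← hb3] at hi3
  linarith

theorem phase_le_of_windows {η : ℝ} {x : ℕ → Fin 3 → ℝ} {r n : ℕ} (hr : 0 < r)
    (h : ∀ l k, l ≤ k → k ≤ n → k ≤ l + r → phase S.q η x k ≤ phase S.q η x l + 2) :
    ∀ k ≤ n, phase S.q η x k ≤ 2 * (k / r + 1) := by
  intro k
  induction k using Nat.strong_induction_on with
  | _ k ih =>
    intro hk
    by_cases hkr : k < r
    · have := h 0 k (by omega) hk (by omega)
      simp only [phase] at this
      generalize k / r = d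
      omega
    · have h1 := ih (k - r) (by omega) (by omega)
      have h2 := h (k - r) k (by omega) hk (by omega)
      have h3 : (k - r) / r + 1 = k / r := by
        rw [Nat.div_eq k r, if_pos ⟨hr, by omega⟩]
      omega

/-- Summation of the increments of the linear functions along the phases. -/
theorem sum_increments_le {h : ℝ≥0} {η : ℝ} (hη : 0 ≤ η) (hz : IsReflected θ R z w y) {n : ℕ}
    (hpos : ∀ k ≤ n, ∀ r : ℝ≥0, k * h ≤ r → r ≤ (k + 1 : ℕ) * h →
      0 < z r (S.q (phase S.q η (fun i => z (i * h)) k + 1))) :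
    ∑ k ∈ Finset.range (n + 1), S.c (phase S.q η (fun i => z (i * h)) k) ⬝ᵥ
      (w ((k + 1 : ℕ) * h) - w (k * h)) ≤
    S.c (phase S.q η (fun i => z (i * h)) n) ⬝ᵥ z ((n + 1 : ℕ) * h) - S.c 0 ⬝ᵥ z 0 +
      S.bound * η * (phase S.q η (fun i => z (i * h)) n) := by
  have hmono : ∀ k : ℕ, (k : ℝ≥0) * h ≤ (k + 1 : ℕ) * h := fun k => by
    gcongr; exact_mod_cast Nat.le_succ k
  induction n with
  | zero =>
    have := S.increment_le hz (hmono 0) _ (hpos 0 le_rfl)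
    simp only [phase, CharP.cast_eq_zero, zero_mul] at this ⊢
    simp only [zero_add, Finset.range_one, Finset.sum_singleton, CharP.cast_eq_zero, zero_mul,
      phase, mul_zero, add_zero] at this ⊢
    exact this
  | succ n ih =>
    rw [Finset.sum_range_succ]
    have h1 := ih fun k hk => hpos k (by omega)
    have h2 := S.increment_le hz (hmono (n + 1)) _ (hpos (n + 1) le_rfl)
    have h3 := S.phase_change hη (hz.nonneg ((n + 1 : ℕ) * h)) (phase S.q η (fun i => z (i * h)) n)
    have h4 : phaseStep S.q η (z ((n + 1 : ℕ) * h)) (phase S.q η (fun i => z (i * h)) n) =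
      phase S.q η (fun i => z (i * h)) (n + 1) := rfl
    rw [h4] at h3
    linarith

end Spiral

end SRBM

/-! ### The gain of a single path on a fine grid. -/

namespace SRBM

theorem exists_modulus {z : ℝ≥0 → Fin 3 → ℝ} (hz : Continuous z) (T : ℝ≥0) {e : ℝ} (he : 0 < e) :
    ∃ d : ℝ≥0, 0 < d ∧ ∀ s t : ℝ≥0, s ≤ t → t ≤ T → t ≤ s + d → ∀ j, |z t j - z s j| < e := by
  have h := (isCompact_Icc (a := (0 : ℝ≥0)) (b := T)).uniformContinuousOn_of_continuous
    hz.continuousOn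
  rw [Metric.uniformContinuousOn_iff] at h
  obtain ⟨d, hd, H⟩ := h e he
  refine ⟨(d / 2).toNNReal, Real.toNNReal_pos.2 (half_pos hd), ?_⟩
  intro s t hst htT htd j
  have h1 : dist t s < d := by
    rw [NNReal.dist_eq, abs_of_nonneg (sub_nonneg.2 (NNReal.coe_le_coe.2 hst))]
    have : (t : ℝ) ≤ s + (d / 2).toNNReal := by exact_mod_cast htd
    rw [Real.coe_toNNReal _ (half_pos hd).le] at this
    linarith
  have h2 := H t ⟨zero_le, htT⟩ s ⟨zero_le, hst.trans htT⟩ h1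
  exact (dist_le_pi_dist (z t) (z s) j).trans_lt h2

theorem exists_le_of_notMem_ball {ε : ℝ} (hε : 0 < ε) {x : Fin 3 → ℝ} (hx : ∀ i, 0 ≤ x i)
    (h : x ∉ Metric.ball (0 : Fin 3 → ℝ) ε) : ∃ i, ε ≤ x i := by
  by_contra! h'
  refine h ?_
  rw [mem_ball_zero_iff, pi_norm_lt_iff hε]
  intro i
  rw [Real.norm_of_nonneg (hx i)]
  exact h' i

namespace Spiral

variable {θ : Fin 3 → ℝ} {R : Matrix (Fin 3) (Fin 3) ℝ} (S : Spiral θ R)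
  {z w y : ℝ≥0 → Fin 3 → ℝ}

open Classical in
/-- The discrete stochastic integral of the phase functions along the grid of mesh `h`, stopped
when the path has visited `A`. -/
noncomputable def gain (η : ℝ) (A : Set (Fin 3 → ℝ)) (z w : ℝ≥0 → Fin 3 → ℝ) (h : ℝ≥0) (n : ℕ) :
    ℝ :=
  ∑ k ∈ Finset.range n, if Avoids A z (k * h) then
    S.c (phase S.q η (fun i => z (i * h)) k) ⬝ᵥ (w ((k + 1 : ℕ) * h) - w (k * h)) else 0

theorem c_dotProduct_le {x : Fin 3 → ℝ} (hx : ∀ i, 0 ≤ x i) {e : ℝ} (hxe : ∀ i, x i ≤ e) (a : ℕ) :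
    S.c a ⬝ᵥ x ≤ e * ∑ i, S.u i := by
  rw [c_dotProduct]
  have h1 : 0 ≤ S.l (S.q a) * x (S.q a) := mul_nonneg (S.l_pos _).le (hx _)
  have h2 : S.u ⬝ᵥ x ≤ e * ∑ i, S.u i := by
    rw [Finset.mul_sum]
    refine Finset.sum_le_sum fun i _ => ?_
    rw [mul_comm]
    exact mul_le_mul_of_nonneg_right (hxe i) (S.u_pos i).le
  linarith

/-- On each grid that is fine enough, the stopped gain of a path that reaches a small
neighbourhood of the origin is bounded away from zero from above. -/
theorem gain_le (hz : IsReflected θ R z w y) (hc : Continuous z) {ε δ : ℝ} (hε : 0 < ε)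
    (hδ : 0 < δ) (h0 : z 0 ∉ Metric.ball (0 : Fin 3 → ℝ) ε)
    (hhit : ∃ s, z s ∈ Metric.ball (0 : Fin 3 → ℝ) ε) (hq1 : 0 < z 0 (S.q 1))
    (hsize : 2 * ε * ∑ i, S.u i + 2 * δ ≤ S.c 0 ⬝ᵥ z 0) :
    ∃ η₀ : ℝ, 0 < η₀ ∧ ∀ η, 0 < η → η < η₀ → ∃ h₀ : ℝ≥0, 0 < h₀ ∧ ∃ T : ℝ≥0,
      ∀ h : ℝ≥0, 0 < h → h < h₀ → ∀ n : ℕ, T ≤ n * h →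
        S.gain η (Metric.ball 0 ε) z w h n ≤ -δ := by
  classical
  obtain ⟨s, hs⟩ := hhit
  obtain ⟨d, hd, Hd⟩ := exists_modulus hc (s + 1) (half_pos hε)
  -- At most two phase changes per window, with windows of length at least `d / 2` covering the time
  -- up to `s + 1`.
  set K : ℝ := 2 * (2 * (s + 1) / d + 1) with hK
  have hKpos : 0 < K := by positivity
  have hΛ := S.bound_pos
  -- The three bounds on `η` serve, in order, the window estimate, the validity of phase zero at
  -- time zero, and a total switching loss of at most `δ`.
  refine ⟨min (ε / 2) (min (z 0 (S.q 1)) (δ / (S.bound * K))), by positivity, ?_⟩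
  intro η hη hη'
  rw [lt_min_iff, lt_min_iff] at hη'
  obtain ⟨hη1, hη2, hη3⟩ := hη'
  obtain ⟨d', hd', Hd'⟩ := exists_modulus hc (s + 1) hη
  -- The bound `1` keeps the grid inside `[0, s + 1]`; `d'` prevents a coordinate above `η` from
  -- reaching zero within one step; `d / 2` gives windows of at least half the length `d`.
  refine ⟨min 1 (min d' (d / 2)), by positivity, s, ?_⟩
  intro h hh hh' n hn
  rw [lt_min_iff, lt_min_iff] at hh'
  obtain ⟨hh1, hh2, hh3⟩ := hh'
  set A := Metric.ball (0 : Fin 3 → ℝ) ε with hA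
  set a := phase S.q η (fun i => z (i * h)) with ha
  have hex : ∃ k : ℕ, ¬ Avoids A z (k * h) := ⟨n, fun hav => hav s hn hs⟩
  -- `N * h` is the first grid time by which the ball has been visited, so the last active step may
  -- run past the visit.
  obtain ⟨N, hN⟩ : ∃ N, N = Nat.find hex := ⟨_, rfl⟩
  have hNn : N ≤ n := hN ▸ Nat.find_min' hex fun hav => hav s hn hs
  have hNspec : ¬ Avoids A z (N * h) := hN ▸ Nat.find_spec hex
  have hNmin : ∀ k < N, Avoids A z (k * h) := fun k hk =>
    not_not.1 (Nat.find_min hex (hN ▸ hk))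
  have hN0 : N ≠ 0 := by
    rintro rfl
    refine hNspec fun r hr => ?_
    have : r = 0 := by simpa using hr
    rw [this]; exact h0
  obtain ⟨I, rfl⟩ := Nat.exists_eq_succ_of_ne_zero hN0
  have hmono : ∀ {i j : ℕ}, i ≤ j → (i : ℝ≥0) * h ≤ j * h := fun hij => by gcongr
  have hsucc : ∀ k : ℕ, ((k + 1 : ℕ) : ℝ≥0) * h = k * h + h := fun k => by push_cast; ring
  have hIs : (I : ℝ≥0) * h < s := by
    by_contra! hle
    exact hNmin I (Nat.lt_succ_self I) s hle hs
  have hT : ∀ k ≤ I + 1, (k : ℝ≥0) * h ≤ s + 1 := by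
    intro k hk
    refine (hmono hk).trans ?_
    rw [hsucc]
    exact add_le_add hIs.le hh1.le
  have hbig : ∀ k ≤ I, ∃ i, ε ≤ z (k * h) i := fun k hk =>
    exists_le_of_notMem_ball hε (hz.nonneg _) (hNmin k (Nat.lt_succ_of_le hk) _ le_rfl)
  -- the gain is the unstopped sum up to the first grid time after the visit
  have hgain : S.gain η A z w h n =
      ∑ k ∈ Finset.range (I + 1), S.c (a k) ⬝ᵥ (w ((k + 1 : ℕ) * h) - w (k * h)) := by
    unfold gain
    rw [← Finset.sum_subset (Finset.range_mono hNn)]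
    · refine Finset.sum_congr rfl fun k hk => ?_
      rw [if_pos (hNmin k (Finset.mem_range.1 hk))]
    · intro k _ hk
      rw [if_neg]
      intro hav
      refine hNspec fun r hr => hav r (hr.trans (hmono ?_))
      simpa using hk
  have hnext : ∀ k ≤ I, η < z (k * h) (S.q (a k + 1)) := by
    intro k hk
    cases k with
    | zero => simpa [ha, phase] using hη2
    | succ k =>
      refine S.lt_phaseStep_next ?_ (a k)
      obtain ⟨i, hi⟩ := hbig (k + 1) hk
      exact ⟨i, by linarith⟩
  have hpos : ∀ k ≤ I, ∀ r : ℝ≥0, k * h ≤ r → r ≤ (k + 1 : ℕ) * h → 0 < z r (S.q (a k + 1)) := by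
    intro k hk r hr1 hr2
    have h1 := Hd' (k * h) r hr1 (hr2.trans (hT _ (by omega)))
      (hr2.trans (by rw [hsucc]; gcongr)) (S.q (a k + 1))
    have h2 := hnext k hk
    rw [abs_lt] at h1
    linarith
  have hsum := S.sum_increments_le hη.le hz hpos
  rw [← ha] at hsum
  -- the number of phase changes
  have hcount : (a I : ℝ) ≤ K := by
    set r := ⌊d / h⌋₊ with hr
    have hdh : 1 < d / h := by
      rw [one_lt_div hh]
      exact hh3.trans (NNReal.half_lt_self hd.ne')
    have hr1 : 0 < r := Nat.floor_pos.2 hdh.le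
    have hrd : (r : ℝ≥0) * h ≤ d := by
      rw [← le_div_iff₀ hh]; exact Nat.floor_le zero_le
    have hrd' : d / 2 ≤ r * h := by
      have h1 : d / h < r + 1 := Nat.lt_floor_add_one _
      rw [div_lt_iff₀ hh] at h1
      rw [← NNReal.coe_le_coe]
      have h2 : (d : ℝ) < (r + 1) * h := by exact_mod_cast h1
      have h3 : (h : ℝ) < d / 2 := by exact_mod_cast hh3
      push_cast
      linarith
    have h1 := S.phase_le_of_windows (η := η) (x := fun i => z (i * h)) (n := I) hr1 (by
      intro l k hlk hk hkr
      refine S.phase_le_add_two hlk (hbig l (by omega)) hη1.le fun i hi1 hi2 j => ?_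
      refine Hd (l * h) (i * h) (hmono hi1) (hT i (by omega)) ?_ j
      calc (i : ℝ≥0) * h ≤ (l + r : ℕ) * h := hmono (by omega)
        _ = l * h + r * h := by push_cast; ring
        _ ≤ _ := by gcongr) I le_rfl
    rw [← ha] at h1
    have h2 : (a I : ℝ) ≤ 2 * (((I / r : ℕ) : ℝ) + 1) := by exact_mod_cast h1
    have h3 : ((I / r : ℕ) : ℝ) ≤ (I : ℝ) / r := Nat.cast_div_le
    have h4 : (I : ℝ) / r ≤ 2 * (s + 1) / d := by
      have hrpos : (0 : ℝ) < r := by exact_mod_cast hr1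
      have hdpos : (0 : ℝ) < d := by exact_mod_cast hd
      rw [div_le_div_iff₀ hrpos hdpos]
      have e1 : (d : ℝ) / 2 ≤ r * h := by exact_mod_cast hrd'
      have e2 : (I : ℝ) * h ≤ s + 1 := by
        have := hT I (by omega)
        exact_mod_cast this
      have e3 : (0 : ℝ) < h := by exact_mod_cast hh
      calc (I : ℝ) * d ≤ I * (2 * (r * h)) := by gcongr; linarith
        _ = 2 * (I * h) * r := by ring
        _ ≤ 2 * (s + 1) * r := by gcongr
    rw [hK]; linarith
  have hloss : S.bound * η * (a I) ≤ δ := by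
    rw [lt_div_iff₀ (by positivity)] at hη3
    calc S.bound * η * (a I) ≤ S.bound * η * K := by gcongr
      _ = η * (S.bound * K) := by ring
      _ ≤ δ := hη3.le
  -- The overshoot past the visit changes each coordinate by less than `ε / 2`, so coordinates stay
  -- below `2 * ε`.
  have hend : S.c (a I) ⬝ᵥ z ((I + 1 : ℕ) * h) ≤ 2 * ε * ∑ i, S.u i := by
    refine S.c_dotProduct_le (hz.nonneg _) (fun i => ?_) _
    simp only [Avoids, not_forall, not_not] at hNspec
    obtain ⟨r, hr1, hr2⟩ := hNspec
    have hr3 : (I : ℝ≥0) * h < r := by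
      by_contra! hle
      exact hNmin I (Nat.lt_succ_self I) r hle hr2
    have h1 := Hd r ((I + 1 : ℕ) * h) hr1 (hT _ le_rfl) (by
      rw [hsucc]
      refine add_le_add hr3.le (hh3.le.trans (NNReal.half_le_self d))) i
    have h2 : z r i < ε := by
      rw [mem_ball_zero_iff] at hr2
      exact (le_abs_self _).trans_lt ((norm_le_pi_norm (z r) i).trans_lt hr2)
    rw [abs_lt] at h1
    linarith
  rw [hgain]
  linarith

end Spiral

end SRBM

/-! ### Construction of the weights from the single-cycle gain. -/

namespace SRBM

/-- Zero drift forces `l p = u ⬝ᵥ θ / θ p`. The quantity `u ⬝ᵥ θ / θ j` separates the two sides of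
the reflection condition: `hv` puts it below `(u ᵥ* R) j`, and `hside`, which says that coordinate
`q a` does not rise on face `j`, puts it above `l (q a) * R (q a) j`. -/
theorem Spiral.nonempty_of_weights {θ : Fin 3 → ℝ} {R : Matrix (Fin 3) (Fin 3) ℝ} (q : ℕ → Fin 3)
    (q_cover : ∀ a j, j = q (a + 1) ∨ j = q (a + 2) ∨ j = q a) (q_period : ∀ a, q (a + 3) = q a)
    (q_ne : q 0 ≠ q 1) (hθ : ∀ i, θ i < 0) (hside : ∀ a j, j ≠ q (a + 1) → θ (q a) ≤ θ j * R (q a) j)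
    (u : Fin 3 → ℝ) (hu : ∀ i, 0 < u i) (hv : ∀ j, θ j * (u ᵥ* R) j ≤ u ⬝ᵥ θ) :
    Nonempty (Spiral θ R) := by
  have hL : u ⬝ᵥ θ < 0 := by
    refine Finset.sum_neg (fun i _ => mul_neg_of_pos_of_neg (hu i) (hθ i)) Finset.univ_nonempty
  refine ⟨⟨q, u, fun p => u ⬝ᵥ θ / θ p, q_cover, q_period, q_ne, hu,
    fun i => div_pos_of_neg_of_neg hL (hθ i), fun p => ?_, fun a j hj => ?_⟩⟩
  · rw [sub_dotProduct, single_dotProduct, div_mul_cancel₀ _ (hθ p).ne, sub_self]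
  · rw [Matrix.sub_vecMul, Matrix.single_vecMul, Pi.sub_apply, sub_nonneg]
    have h1 : u ⬝ᵥ θ / θ j ≤ (u ᵥ* R) j := by
      rw [div_le_iff_of_neg (hθ j), mul_comm]; exact hv j
    refine le_trans ?_ h1
    change u ⬝ᵥ θ / θ (q a) * R (q a) j ≤ _
    rw [div_mul_eq_mul_div, div_le_iff_of_neg (hθ _), div_mul_eq_mul_div, div_le_iff_of_neg (hθ _)]
    have := mul_le_mul_of_nonpos_left (hside a j hj) hL.le
    linarith

/-- Weights balancing a product of three ratios. -/
theorem exists_weights {A A' A'' B B' B'' : ℝ} (hA' : 0 < A') (hA'' : 0 < A'')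
    (hB' : 0 < B') (hB'' : 0 < B'') (h : B * B' * B'' ≤ A * A' * A'') :
    ∃ u : Fin 3 → ℝ, (∀ i, 0 < u i) ∧ u 2 * B ≤ u 0 * A ∧ u 0 * B' ≤ u 1 * A' ∧
      u 1 * B'' ≤ u 2 * A'' := by
  refine ⟨![A' * A'', B' * A'', B' * B''], ?_, ?_, ?_, ?_⟩
  · intro i; fin_cases i <;> simp <;> positivity
  · simp; linarith
  · simp; linarith
  · simp; linarith

theorem exists_spiral_of_mem_C₁ {θ : Fin 3 → ℝ} {R : Matrix (Fin 3) (Fin 3) ℝ}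
    (hdiag : ∀ i, R i i = 1) (hC : (θ, R) ∈ C₁) (hβ : 1 ≤ β₁ θ R) : Nonempty (Spiral θ R) := by
  obtain ⟨hθ, ⟨h1, h2⟩, ⟨h3, h4⟩, ⟨h5, h6⟩⟩ := hC
  simp only at hθ h1 h2 h3 h4 h5 h6
  have hprod : (θ 1 * R 2 1 - θ 2) * (θ 2 * R 0 2 - θ 0) * (θ 0 * R 1 0 - θ 1) ≤
      (θ 0 - θ 1 * R 0 1) * (θ 1 - θ 2 * R 1 2) * (θ 2 - θ 0 * R 2 0) := by
    have h : 0 < (θ 1 * R 2 1 - θ 2) * (θ 2 * R 0 2 - θ 0) * (θ 0 * R 1 0 - θ 1) :=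
      mul_pos (mul_pos (by linarith) (by linarith)) (by linarith)
    rwa [β₁, div_mul_div_comm, div_mul_div_comm, one_le_div h] at hβ
  obtain ⟨u, hu, hu1, hu2, hu3⟩ := exists_weights (by linarith) (by linarith) (by linarith)
    (by linarith) hprod
  refine Spiral.nonempty_of_weights (fun a => Fin.ofNat 3 a) ?_ ?_ (by decide) hθ ?_ u hu ?_
  · intro a j; fin_cases j <;> simp [Fin.ext_iff] <;> omega
  · intro a; simp [Fin.ext_iff]
  · intro a j hj
    obtain h | h | h : a % 3 = 0 ∨ a % 3 = 1 ∨ a % 3 = 2 := by omega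
    · have e : Fin.ofNat 3 a = 0 := by simp [Fin.ext_iff, h]
      have e' : Fin.ofNat 3 (a + 1) = 1 := by simp [Fin.ext_iff]; omega
      simp only [e, e'] at hj ⊢
      fin_cases j
      · simp [hdiag]
      · simp at hj
      · exact h4.le
    · have e : Fin.ofNat 3 a = 1 := by simp [Fin.ext_iff, h]
      have e' : Fin.ofNat 3 (a + 1) = 2 := by simp [Fin.ext_iff]; omega
      simp only [e, e'] at hj ⊢
      fin_cases j
      · exact h6.le
      · simp [hdiag]
      · simp at hj
    · have e : Fin.ofNat 3 a = 2 := by simp [Fin.ext_iff, h]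
      have e' : Fin.ofNat 3 (a + 1) = 0 := by simp [Fin.ext_iff]; omega
      simp only [e, e'] at hj ⊢
      fin_cases j
      · simp at hj
      · exact h2.le
      · simp [hdiag]
  · intro j
    fin_cases j <;> simp [Matrix.vecMul, dotProduct, Fin.sum_univ_three, hdiag] <;> linarith

theorem exists_spiral_of_mem_C₂ {θ : Fin 3 → ℝ} {R : Matrix (Fin 3) (Fin 3) ℝ}
    (hdiag : ∀ i, R i i = 1) (hC : (θ, R) ∈ C₂) (hβ : 1 ≤ β₂ θ R) : Nonempty (Spiral θ R) := by
  obtain ⟨hθ, ⟨h1, h2⟩, ⟨h3, h4⟩, ⟨h5, h6⟩⟩ := hC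
  simp only at hθ h1 h2 h3 h4 h5 h6
  have hprod : (θ 1 * R 0 1 - θ 0) * (θ 0 * R 2 0 - θ 2) * (θ 2 * R 1 2 - θ 1) ≤
      (θ 2 - θ 1 * R 2 1) * (θ 1 - θ 0 * R 1 0) * (θ 0 - θ 2 * R 0 2) := by
    have h : 0 < (θ 1 * R 0 1 - θ 0) * (θ 0 * R 2 0 - θ 2) * (θ 2 * R 1 2 - θ 1) :=
      mul_pos (mul_pos (by linarith) (by linarith)) (by linarith)
    have e : β₂ θ R = ((θ 2 - θ 1 * R 2 1) * (θ 1 - θ 0 * R 1 0) * (θ 0 - θ 2 * R 0 2)) /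
        ((θ 1 * R 0 1 - θ 0) * (θ 0 * R 2 0 - θ 2) * (θ 2 * R 1 2 - θ 1)) := by
      rw [β₂, β₁, div_mul_div_comm, div_mul_div_comm, one_div_div, ← neg_div_neg_eq]
      congr 1 <;> ring
    rwa [e, one_le_div h] at hβ
  obtain ⟨v, hv, hv1, hv2, hv3⟩ := exists_weights (by linarith) (by linarith) (by linarith)
    (by linarith) hprod
  -- The clockwise order is `0, 2, 1`; exchanging the coordinates `0` and `2` also reverses the
  -- weights.
  refine Spiral.nonempty_of_weights (fun a => Fin.ofNat 3 (2 * a)) ?_ ?_ (by decide) hθ ?_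
    ![v 2, v 1, v 0] ?_ ?_
  · intro a j
    obtain h | h | h : a % 3 = 0 ∨ a % 3 = 1 ∨ a % 3 = 2 := by omega
    all_goals fin_cases j <;> simp [Fin.ext_iff] <;> omega
  · intro a; simp [Fin.ext_iff]; omega
  · intro a j hj
    obtain h | h | h : a % 3 = 0 ∨ a % 3 = 1 ∨ a % 3 = 2 := by omega
    · have e : Fin.ofNat 3 (2 * a) = 0 := by simp [Fin.ext_iff]; omega
      have e' : Fin.ofNat 3 (2 * (a + 1)) = 2 := by simp [Fin.ext_iff]; omega
      simp only [e, e'] at hj ⊢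
      fin_cases j
      · simp [hdiag]
      · exact h1.le
      · simp at hj
    · have e : Fin.ofNat 3 (2 * a) = 2 := by simp [Fin.ext_iff]; omega
      have e' : Fin.ofNat 3 (2 * (a + 1)) = 1 := by simp [Fin.ext_iff]; omega
      simp only [e, e'] at hj ⊢
      fin_cases j
      · exact h5.le
      · simp at hj
      · simp [hdiag]
    · have e : Fin.ofNat 3 (2 * a) = 1 := by simp [Fin.ext_iff]; omega
      have e' : Fin.ofNat 3 (2 * (a + 1)) = 0 := by simp [Fin.ext_iff]; omega
      simp only [e, e'] at hj ⊢
      fin_cases j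
      · simp at hj
      · simp [hdiag]
      · exact h3.le
  · intro i; fin_cases i <;> simp [hv]
  · intro j
    fin_cases j <;> simp [Matrix.vecMul, dotProduct, Fin.sum_univ_three, hdiag] <;> linarith

theorem exists_spiral {θ : Fin 3 → ℝ} {R : Matrix (Fin 3) (Fin 3) ℝ}
    (hdiag : ∀ i, R i i = 1) (hC : (θ, R) ∈ C) (hβ : 1 ≤ β θ R) : Nonempty (Spiral θ R) := by
  unfold β at hβ
  split_ifs at hβ with h
  · exact exists_spiral_of_mem_C₁ hdiag h hβ
  · exact exists_spiral_of_mem_C₂ hdiag (hC.resolve_left h) hβ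

end SRBM

/-! ### Measurability, hitting times and probability estimates. -/

namespace SRBM

variable {Ω : Type*} {mΩ : MeasurableSpace Ω} {P : Measure Ω} {ℱ : Filtration ℝ≥0 mΩ}

theorem IsBrownianMotion.isScalarBM {d : ℕ} {Γ : Matrix (Fin d) (Fin d) ℝ} (hΓ : Γ.PosSemidef)
    {W : ℝ≥0 → Ω → Fin d → ℝ} (hW : IsBrownianMotion Γ W P) (hM : Martingale W ℱ P) (i : Fin d) :
    IsScalarBM (Γ i i).toNNReal ℱ (fun t ω => W t ω i) P where
  martingale := by
    let T : (Fin d → ℝ) →L[ℝ] ℝ := ContinuousLinearMap.proj i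
    refine ⟨fun t => T.continuous.comp_stronglyMeasurable (hM.1 t), fun s t hst => ?_⟩
    have h1 := T.comp_condExp_comm (m := ℱ s) (hM.integrable t)
    filter_upwards [h1, hM.2 s t hst] with ω a b
    rw [Function.comp_apply, b] at a
    exact a.symm
  indep := hW.indep.map (ContinuousLinearMap.proj i : (Fin d → ℝ) →L[ℝ] ℝ)
  law s t hst := by
    have hS : (((t : ℝ) - (s : ℝ)) • Γ).PosSemidef :=
      hΓ.smul (sub_nonneg.2 (NNReal.coe_le_coe.2 hst))
    have h := (measurePreserving_eval_multivariateGaussian (μ := 0) hS (i := i)).comp_hasLaw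
      (hW.law s t hst)
    have e : ((((t : ℝ) - (s : ℝ)) • Γ) i i).toNNReal = (t - s) * (Γ i i).toNNReal := by
      rw [Matrix.smul_apply, smul_eq_mul, Real.toNNReal_mul (sub_nonneg.2 (NNReal.coe_le_coe.2 hst)),
        ← NNReal.sub_def]
    rw [e] at h
    exact h

/-- Since `A` is open and paths are continuous, it suffices to avoid `A` on a countable dense set of
times in `[0, t]`. -/
theorem measurableSet_avoids {Z : ℝ≥0 → Ω → Fin 3 → ℝ} (hZ : StronglyAdapted ℱ Z)
    (hc : ∀ ω, Continuous fun t => Z t ω) {A : Set (Fin 3 → ℝ)} (hA : IsOpen A) (t : ℝ≥0) :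
    MeasurableSet[ℱ t] {ω | Avoids A (fun s => Z s ω) t} := by
  have : Nonempty (Set.Iic t) := ⟨⟨t, le_refl t⟩⟩
  have e : {ω | Avoids A (fun s => Z s ω) t} =
      ⋂ n : ℕ, {ω | Z (TopologicalSpace.denseSeq (Set.Iic t) n) ω ∉ A} := by
    ext ω
    simp only [Avoids, Set.mem_ofPred_eq, Set.mem_iInter]
    refine ⟨fun h n => h _ (TopologicalSpace.denseSeq (Set.Iic t) n).2, fun h r hr => ?_⟩
    have hcl : IsClosed {r : Set.Iic t | Z r ω ∉ A} :=
      hA.isClosed_compl.preimage ((hc ω).comp continuous_subtype_val)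
    exact (TopologicalSpace.denseRange_denseSeq (Set.Iic t)).induction_on
      (p := fun r => Z r ω ∉ A) ⟨r, hr⟩ hcl h
  rw [e]
  refine MeasurableSet.iInter fun n => ?_
  have h1 := ((hZ _).mono (ℱ.mono (TopologicalSpace.denseSeq (Set.Iic t) n).2)).measurable
  exact h1 hA.measurableSet.compl

theorem measurable_phase {Z : ℝ≥0 → Ω → Fin 3 → ℝ} (hZ : StronglyAdapted ℱ Z) (q : ℕ → Fin 3)
    (η : ℝ) (h : ℝ≥0) (k : ℕ) :
    Measurable[ℱ (k * h)] fun ω => phase q η (fun i => Z (i * h) ω) k := by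
  induction k with
  | zero => exact measurable_const
  | succ k ih =>
    have hle : (k : ℝ≥0) * h ≤ (k + 1 : ℕ) * h := by
      gcongr; exact_mod_cast Nat.le_succ k
    have h1 : Measurable[ℱ ((k + 1 : ℕ) * h)] fun ω => phase q η (fun i => Z (i * h) ω) k :=
      ih.mono (ℱ.mono hle) le_rfl
    have h2 : Measurable[ℱ ((k + 1 : ℕ) * h)] (Z ((k + 1 : ℕ) * h)) := (hZ _).measurable
    have h3 : Measurable fun p : (Fin 3 → ℝ) × ℕ => phaseStep q η p.1 p.2 := by
      refine measurable_from_prod_countable_left fun a => ?_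
      change Measurable fun z : Fin 3 → ℝ =>
        if η < z (q (a + 1)) then a else if η < z (q (a + 2)) then a + 1 else a + 2
      refine Measurable.ite ?_ measurable_const (Measurable.ite ?_ measurable_const measurable_const)
      · exact measurableSet_lt measurable_const (measurable_pi_apply _)
      · exact measurableSet_lt measurable_const (measurable_pi_apply _)
    exact h3.comp (h2.prodMk h1)

/-- Time spent on the grid before `τ`. -/
theorem sum_grid_le (τ : ℝ≥0∞) (h : ℝ≥0) (D : ℕ → Prop) [DecidablePred D]
    (hD : ∀ k, D k → ((k * h : ℝ≥0) : ℝ≥0∞) ≤ τ) (n : ℕ) :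
    ∑ k ∈ Finset.range n, (if D k then (h : ℝ≥0∞) else 0) ≤ τ + h := by
  have h1 : ∀ n : ℕ, ∑ k ∈ Finset.range n, (if D k then (h : ℝ≥0∞) else 0) ≤
      ((n * h : ℝ≥0) : ℝ≥0∞) := by
    intro n
    calc _ ≤ ∑ k ∈ Finset.range n, (h : ℝ≥0∞) := Finset.sum_le_sum fun k _ => by
          split_ifs <;> simp
      _ = _ := by simp
  induction n with
  | zero => simp
  | succ n ih =>
    rw [Finset.sum_range_succ]
    by_cases hn : D n
    · rw [if_pos hn]
      gcongr
      exact (h1 n).trans (hD n hn)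
    · rw [if_neg hn, add_zero]; exact ih

theorem Avoids.le_hittingTime {Z : ℝ≥0 → Ω → Fin 3 → ℝ} {A : Set (Fin 3 → ℝ)} {t : ℝ≥0} {ω : Ω}
    (h : Avoids A (fun s => Z s ω) t) : (t : ℝ≥0∞) ≤ hittingTime Z A ω := by
  refine le_iInf₂ fun r hr => ?_
  by_contra! hlt
  exact h r (by exact_mod_cast hlt.le) hr

theorem sum_measure_avoids_le [IsProbabilityMeasure P] {Z : ℝ≥0 → Ω → Fin 3 → ℝ}
    (hZ : StronglyAdapted ℱ Z) (hc : ∀ ω, Continuous fun t => Z t ω) {A : Set (Fin 3 → ℝ)}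
    (hA : IsOpen A) (hτ : ∫⁻ ω, hittingTime Z A ω ∂P < ∞) (h : ℝ≥0) (n : ℕ) :
    ∑ k ∈ Finset.range n, h * P.real {ω | Avoids A (fun s => Z s ω) (k * h)} ≤
      (∫⁻ ω, hittingTime Z A ω ∂P).toReal + h := by
  classical
  have hm : ∀ k : ℕ, MeasurableSet {ω | Avoids A (fun s => Z s ω) (k * h)} := fun k =>
    ℱ.le _ _ (measurableSet_avoids hZ hc hA _)
  have h1 : ∑ k ∈ Finset.range n, (h : ℝ≥0∞) * P {ω | Avoids A (fun s => Z s ω) (k * h)} ≤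
      ∫⁻ ω, hittingTime Z A ω ∂P + h := by
    calc _ = ∫⁻ ω, ∑ k ∈ Finset.range n,
          (if Avoids A (fun s => Z s ω) (k * h) then (h : ℝ≥0∞) else 0) ∂P := by
          rw [lintegral_finsetSum]
          · refine Finset.sum_congr rfl fun k _ => ?_
            rw [← lintegral_indicator_const (hm k)]
            rfl
          · intro k _
            exact Measurable.ite (hm k) measurable_const measurable_const
      _ ≤ ∫⁻ ω, (hittingTime Z A ω + h) ∂P :=
          lintegral_mono fun ω => sum_grid_le _ h _ (fun k hk => hk.le_hittingTime) n
      _ = _ := by rw [lintegral_add_right _ measurable_const]; simp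
  have h2 := ENNReal.toReal_mono (by finiteness) h1
  rw [ENNReal.toReal_add hτ.ne (by finiteness), ENNReal.toReal_sum (fun k _ => by finiteness)] at h2
  simpa [Measure.real] using h2

theorem ae_exists_mem_of_hittingTime [IsProbabilityMeasure P] {Z : ℝ≥0 → Ω → Fin 3 → ℝ}
    (hZ : StronglyAdapted ℱ Z) (hc : ∀ ω, Continuous fun t => Z t ω) {A : Set (Fin 3 → ℝ)}
    (hA : IsOpen A) (hτ : ∫⁻ ω, hittingTime Z A ω ∂P < ∞) : ∀ᵐ ω ∂P, ∃ s, Z s ω ∈ A := by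
  set M : Set Ω := ⋂ n : ℕ, {ω | Avoids A (fun s => Z s ω) n} with hM
  have hMm : MeasurableSet M :=
    MeasurableSet.iInter fun n => ℱ.le _ _ (measurableSet_avoids hZ hc hA _)
  have h1 : ∫⁻ ω, M.indicator (fun _ => ∞) ω ∂P < ∞ := by
    refine (lintegral_mono fun ω => ?_).trans_lt hτ
    by_cases hω : ω ∈ M
    · rw [Set.indicator_of_mem hω, top_le_iff]
      refine ENNReal.eq_top_of_forall_nnreal_le fun r => ?_
      obtain ⟨n, hn⟩ := exists_nat_ge r
      exact le_trans (by exact_mod_cast hn) (Set.mem_iInter.1 hω n).le_hittingTime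
    · rw [Set.indicator_of_notMem hω]; exact zero_le
  rw [lintegral_indicator_const hMm] at h1
  have h2 : P M = 0 := by
    by_contra h0
    rw [ENNReal.top_mul h0] at h1
    exact lt_irrefl _ h1
  rw [ae_iff]
  refine measure_mono_null (fun ω hω => Set.mem_iInter.2 fun n r _ hr => hω ⟨r, hr⟩) h2

/-- Continuity from above along the tail unions. This replaces a convergence statement: a lower
bound on probabilities survives passage to the limsup of events. -/
theorem le_measure_frequently [IsFiniteMeasure P] {E : ℕ → Set Ω} (hE : ∀ n, MeasurableSet (E n))
    {κ : ℝ≥0∞} (h : ∀ n, κ ≤ P (E n)) :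
    MeasurableSet {ω | ∃ᶠ n in Filter.atTop, ω ∈ E n} ∧
      κ ≤ P {ω | ∃ᶠ n in Filter.atTop, ω ∈ E n} := by
  have e : {ω | ∃ᶠ n in Filter.atTop, ω ∈ E n} = ⋂ n : ℕ, ⋃ m, ⋃ (_ : n ≤ m), E m := by
    ext ω
    simp [Filter.frequently_atTop]
  have hm : ∀ n : ℕ, MeasurableSet (⋃ m, ⋃ (_ : n ≤ m), E m) := fun n =>
    MeasurableSet.iUnion fun m => MeasurableSet.iUnion fun _ => hE m
  rw [e]
  refine ⟨MeasurableSet.iInter hm, ?_⟩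
  have := tendsto_measure_iInter_atTop (μ := P) (fun n => (hm n).nullMeasurableSet)
    (fun i j hij => Set.iUnion_mono fun m => Set.iUnion_mono' fun hm' => ⟨hij.trans hm', subset_rfl⟩)
    ⟨0, measure_ne_top _ _⟩
  refine ge_of_tendsto' this fun n => (h n).trans (measure_mono ?_)
  exact Set.subset_iUnion₂_of_subset n le_rfl subset_rfl

/-- A centred random variable with a bounded second moment is not mostly negative. -/
theorem le_measure_of_integral_eq_zero [IsProbabilityMeasure P] {N : Ω → ℝ} (hN : MemLp N 2 P)
    (hNm : Measurable N) (h0 : ∫ ω, N ω ∂P = 0) {V δ : ℝ} (hV : 0 ≤ V) (hδ : 0 < δ)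
    (h2 : ∫ ω, N ω ^ 2 ∂P ≤ V) :
    δ / 2 / ((V + 1) / (2 * δ) + δ) ≤ P.real {ω | -δ < N ω} := by
  have hm : MeasurableSet {ω | -δ < N ω} := measurableSet_lt measurable_const hNm
  set b : ℝ := (V + 1) / (2 * δ) + δ with hb
  have hbpos : 0 < b := by positivity
  set I : Ω → ℝ := Set.indicator {ω | -δ < N ω} fun _ => b with hI
  -- On `-δ < N` this is Young's inequality, with `b` the resulting constant. The quadratic
  -- coefficient is chosen so that this term has mean at most `δ / 2`; `V + 1` avoids division by
  -- zero.
  have hpt : ∀ ω, N ω ≤ δ / (V + 1) / 2 * N ω ^ 2 + I ω - δ := by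
    intro ω
    by_cases hω : -δ < N ω
    · have : I ω = b := Set.indicator_of_mem (s := {ω | -δ < N ω}) hω _
      rw [this, hb]
      have h3 : N ω ≤ δ / (V + 1) / 2 * N ω ^ 2 + (V + 1) / (2 * δ) := by
        have e : δ / (V + 1) / 2 * N ω ^ 2 + (V + 1) / (2 * δ) - N ω =
            (δ * N ω - (V + 1)) ^ 2 / (2 * δ * (V + 1)) := by
          field_simp; ring
        have : 0 ≤ (δ * N ω - (V + 1)) ^ 2 / (2 * δ * (V + 1)) := by positivity
        linarith
      linarith
    · have : I ω = 0 := Set.indicator_of_notMem (s := {ω | -δ < N ω}) hω _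
      rw [this]
      have : 0 ≤ δ / (V + 1) / 2 * N ω ^ 2 := by positivity
      linarith
  have hIi : Integrable I P := (integrable_const b).indicator hm
  have hsq : Integrable (fun ω => δ / (V + 1) / 2 * N ω ^ 2) P := hN.integrable_sq.const_mul _
  have hs : Integrable (fun ω => δ / (V + 1) / 2 * N ω ^ 2 + I ω) P := hsq.add hIi
  have h3 := integral_mono (hN.integrable (by norm_num)) (hs.sub (integrable_const δ)) hpt
  rw [h0] at h3
  have h4 : ∫ ω, (δ / (V + 1) / 2 * N ω ^ 2 + I ω - δ) ∂P =
      δ / (V + 1) / 2 * ∫ ω, N ω ^ 2 ∂P + b * P.real {ω | -δ < N ω} - δ := by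
    rw [integral_sub hs (integrable_const δ), integral_add hsq hIi, integral_const_mul,
      integral_indicator hm]
    simp [mul_comm]
  have h5 : δ / (V + 1) / 2 * ∫ ω, N ω ^ 2 ∂P ≤ δ / 2 := by
    calc δ / (V + 1) / 2 * ∫ ω, N ω ^ 2 ∂P ≤ δ / (V + 1) / 2 * (V + 1) := by
          gcongr; linarith
      _ = δ / 2 := by field_simp
  rw [div_le_iff₀ hbpos]
  have h6 : (0 : ℝ) ≤ δ / (V + 1) / 2 * ∫ ω, N ω ^ 2 ∂P + b * P.real {ω | -δ < N ω} - δ := by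
    rw [← h4]; exact h3
  linarith

end SRBM

/-! ### Moments of the stopped gain and the contradiction. -/

namespace SRBM

namespace Spiral

variable {Ω : Type*} {mΩ : MeasurableSpace Ω} {P : Measure Ω} {ℱ : Filtration ℝ≥0 mΩ}
  {θ : Fin 3 → ℝ} {R : Matrix (Fin 3) (Fin 3) ℝ} (S : Spiral θ R)
  {Z W : ℝ≥0 → Ω → Fin 3 → ℝ} {A : Set (Fin 3 → ℝ)}

/-- A bound of the entries of the linear functions `c`. -/
def entryBound : ℝ := ∑ i, S.u i + S.bound

theorem entryBound_nonneg : 0 ≤ S.entryBound :=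
  add_nonneg (Finset.sum_nonneg fun i _ => (S.u_pos i).le) S.bound_pos.le

theorem abs_c_le (a : ℕ) (i : Fin 3) : |S.c a i| ≤ S.entryBound := by
  have h1 : S.u i ≤ ∑ i, S.u i :=
    Finset.single_le_sum (f := S.u) (fun i _ => (S.u_pos i).le) (Finset.mem_univ i)
  have h2 : |(Pi.single (S.q a) (S.l (S.q a)) : Fin 3 → ℝ) i| ≤ S.bound := by
    rw [Pi.single_apply]
    split_ifs
    · rw [abs_of_pos (S.l_pos _)]; exact S.l_le_bound _
    · simpa using S.bound_pos.le
  calc |S.c a i| ≤ |S.u i| + |(Pi.single (S.q a) (S.l (S.q a)) : Fin 3 → ℝ) i| := abs_sub _ _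
    _ ≤ S.entryBound := by
      rw [abs_of_pos (S.u_pos i)]
      exact add_le_add h1 h2

open Classical in
/-- The integrand of the `i`th coordinate in the stopped gain. -/
noncomputable def integrand (η : ℝ) (A : Set (Fin 3 → ℝ)) (Z : ℝ≥0 → Ω → Fin 3 → ℝ) (h : ℝ≥0)
    (i : Fin 3) (k : ℕ) (ω : Ω) : ℝ :=
  if Avoids A (fun s => Z s ω) (k * h) then S.c (phase S.q η (fun j => Z (j * h) ω) k) i else 0

theorem gain_eq_sum_transform (η : ℝ) (A : Set (Fin 3 → ℝ)) (Z W : ℝ≥0 → Ω → Fin 3 → ℝ) (h : ℝ≥0)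
    (n : ℕ) (ω : Ω) :
    S.gain η A (fun s => Z s ω) (fun s => W s ω) h n =
      ∑ i, transform (fun t ω => W t ω i) (fun k => k * h) (S.integrand η A Z h i) n ω := by
  simp only [gain, transform, integrand]
  rw [Finset.sum_comm]
  refine Finset.sum_congr rfl fun k _ => ?_
  split_ifs
  · simp [dotProduct]
  · simp

theorem stronglyMeasurable_integrand (hZ : StronglyAdapted ℱ Z)
    (hc : ∀ ω, Continuous fun t => Z t ω) (hA : IsOpen A) (η : ℝ) (h : ℝ≥0) (i : Fin 3) (k : ℕ) :
    StronglyMeasurable[ℱ (k * h)] (S.integrand η A Z h i k) := by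
  refine Measurable.stronglyMeasurable ?_
  refine Measurable.ite (measurableSet_avoids hZ hc hA _) ?_ measurable_const
  exact (measurable_from_nat (f := fun a => S.c a i)).comp (measurable_phase hZ S.q η h k)

theorem abs_integrand_le (η : ℝ) (h : ℝ≥0) (i : Fin 3) (k : ℕ) (ω : Ω) :
    |S.integrand η A Z h i k ω| ≤ S.entryBound := by
  unfold integrand
  split_ifs
  · exact S.abs_c_le _ _
  · simpa using S.entryBound_nonneg

theorem monotone_grid (h : ℝ≥0) : Monotone fun k : ℕ => (k : ℝ≥0) * h := by
  intro i j hij; dsimp only; gcongr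

section Moments

variable (hZ : StronglyAdapted ℱ Z) (hc : ∀ ω, Continuous fun t => Z t ω)
  (hA : IsOpen A) {g : Fin 3 → ℝ≥0} (hW : ∀ i, IsScalarBM (g i) ℱ (fun t ω => W t ω i) P)

include hZ hc hA hW

theorem memLp_gain (η : ℝ) (h : ℝ≥0) (n : ℕ) :
    MemLp (fun ω => S.gain η A (fun s => Z s ω) (fun s => W s ω) h n) 2 P := by
  simp_rw [gain_eq_sum_transform]
  exact memLp_finsetSum _ fun i _ => memLp_transform (fun s t hst => (hW i).memLp hst)
    (monotone_grid h) (fun k => S.stronglyMeasurable_integrand hZ hc hA η h i k)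
    (S.abs_integrand_le η h i) n

theorem measurable_gain (η : ℝ) (h : ℝ≥0) (n : ℕ) :
    Measurable fun ω => S.gain η A (fun s => Z s ω) (fun s => W s ω) h n := by
  simp_rw [gain_eq_sum_transform]
  refine Finset.measurable_fun_sum _ fun i _ => ?_
  exact ((stronglyMeasurable_transform (hW i).martingale (monotone_grid h)
    (fun k => S.stronglyMeasurable_integrand hZ hc hA η h i k) n).mono (ℱ.le _)).measurable

variable [IsProbabilityMeasure P]

theorem integral_gain (η : ℝ) (h : ℝ≥0) (n : ℕ) :
    ∫ ω, S.gain η A (fun s => Z s ω) (fun s => W s ω) h n ∂P = 0 := by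
  simp_rw [gain_eq_sum_transform]
  rw [integral_finsetSum]
  · refine Finset.sum_eq_zero fun i _ => ?_
    exact integral_transform (hW i).martingale (fun s t hst => (hW i).memLp hst)
      (monotone_grid h) (fun k => S.stronglyMeasurable_integrand hZ hc hA η h i k)
      (S.abs_integrand_le η h i) n
  · intro i _
    exact (memLp_transform (fun s t hst => (hW i).memLp hst)
      (monotone_grid h) (fun k => S.stronglyMeasurable_integrand hZ hc hA η h i k)
      (S.abs_integrand_le η h i) n).integrable (by norm_num)

/-- By the discrete isometry, each cell contributes at most a constant times `h` times the
probability of not having visited `A` at its start. These sum to the mean hitting time, plus `h` for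
the last cell. -/
theorem integral_transform_integrand_sq_le (hτ : ∫⁻ ω, hittingTime Z A ω ∂P < ∞) (η : ℝ) (h : ℝ≥0)
    (i : Fin 3) (n : ℕ) :
    ∫ ω, transform (fun t ω => W t ω i) (fun k => k * h) (S.integrand η A Z h i) n ω ^ 2 ∂P ≤
      S.entryBound ^ 2 * g i * ((∫⁻ ω, hittingTime Z A ω ∂P).toReal + h) := by
  rw [integral_transform_sq (hW i).martingale (fun s t hst => (hW i).memLp hst)
    (monotone_grid h) (fun k => S.stronglyMeasurable_integrand hZ hc hA η h i k)
    (S.abs_integrand_le η h i) n]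
  refine le_trans ?_ (mul_le_mul_of_nonneg_left (sum_measure_avoids_le hZ hc hA hτ h n)
    (by positivity))
  rw [Finset.mul_sum]
  refine Finset.sum_le_sum fun k _ => ?_
  have hle : (k : ℝ≥0) * h ≤ (k + 1 : ℕ) * h := monotone_grid h (Nat.le_succ k)
  have hm := measurableSet_avoids hZ hc hA (k * h)
  set D : Set Ω := {ω | Avoids A (fun s => Z s ω) (k * h)} with hD
  have hi : Integrable (fun ω => (W ((k + 1 : ℕ) * h) ω i - W (k * h) ω i) ^ 2) P :=
    ((hW i).memLp hle).integrable_sq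
  have h1 := (hW i).setIntegral_sq_le hle hm
  have h2 : ∫ ω, (S.integrand η A Z h i k ω * (W ((k + 1 : ℕ) * h) ω i - W (k * h) ω i)) ^ 2 ∂P ≤
      ∫ ω, S.entryBound ^ 2 *
        D.indicator (fun ω => (W ((k + 1 : ℕ) * h) ω i - W (k * h) ω i) ^ 2) ω ∂P := by
    refine integral_mono ?_ ((hi.indicator (ℱ.le _ _ hm)).const_mul _) fun ω => ?_
    · exact (memLp_two_mul_of_bounded ((S.stronglyMeasurable_integrand hZ hc hA η h i k).mono
        (ℱ.le _)).aestronglyMeasurable (S.abs_integrand_le η h i k) ((hW i).memLp hle)).integrable_sq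
    · by_cases hω : ω ∈ D
      · dsimp only
        rw [Set.indicator_of_mem hω, mul_pow]
        gcongr ?_ * _
        rw [← sq_abs]
        gcongr
        exact S.abs_integrand_le η h i k ω
      · have : S.integrand η A Z h i k ω = 0 := if_neg hω
        simp [this, hω]
  rw [integral_const_mul, integral_indicator (ℱ.le _ _ hm)] at h2
  refine h2.trans ?_
  have e : (((k + 1 : ℕ) : ℝ≥0) * h : ℝ≥0) - ((k : ℝ≥0) * h : ℝ≥0) = (h : ℝ) := by
    push_cast; ring
  rw [e] at h1
  calc _ ≤ S.entryBound ^ 2 * (h * g i * P.real D) := by gcongr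
    _ = _ := by ring

theorem integral_gain_sq_le (hτ : ∫⁻ ω, hittingTime Z A ω ∂P < ∞) (η : ℝ) {h : ℝ≥0} (hh : h ≤ 1)
    (n : ℕ) :
    ∫ ω, S.gain η A (fun s => Z s ω) (fun s => W s ω) h n ^ 2 ∂P ≤
      3 * ∑ i, S.entryBound ^ 2 * g i * ((∫⁻ ω, hittingTime Z A ω ∂P).toReal + 1) := by
  simp_rw [gain_eq_sum_transform]
  have hL : ∀ i, MemLp (transform (fun t ω => W t ω i) (fun k => k * h) (S.integrand η A Z h i) n)
      2 P := fun i => memLp_transform (fun s t hst => (hW i).memLp hst)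
    (monotone_grid h) (fun k => S.stronglyMeasurable_integrand hZ hc hA η h i k)
    (S.abs_integrand_le η h i) n
  calc _ ≤ ∫ ω, 3 * ∑ i, transform (fun t ω => W t ω i) (fun k => k * h)
          (S.integrand η A Z h i) n ω ^ 2 ∂P := by
        refine integral_mono (memLp_finsetSum _ fun i _ => hL i).integrable_sq
          ((integrable_finsetSum _ fun i _ => (hL i).integrable_sq).const_mul 3) fun ω => ?_
        simpa using sq_sum_le_card_mul_sum_sq (s := Finset.univ) (f := fun i : Fin 3 =>
          transform (fun t ω => W t ω i) (fun k => k * h) (S.integrand η A Z h i) n ω)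
    _ = 3 * ∑ i, ∫ ω, transform (fun t ω => W t ω i) (fun k => k * h)
          (S.integrand η A Z h i) n ω ^ 2 ∂P := by
        rw [integral_const_mul, integral_finsetSum _ fun i _ => (hL i).integrable_sq]
    _ ≤ _ := by
        gcongr with i
        refine (S.integral_transform_integrand_sq_le hZ hc hA hW hτ η h i n).trans ?_
        gcongr
        exact_mod_cast hh

end Moments

/-- The process cannot reach a small neighbourhood of the origin in finite mean time. -/
theorem not_lintegral_hittingTime_lt_top [IsProbabilityMeasure P] (hZ : StronglyAdapted ℱ Z)
    (hc : ∀ ω, Continuous fun t => Z t ω) {g : Fin 3 → ℝ≥0}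
    (hW : ∀ i, IsScalarBM (g i) ℱ (fun t ω => W t ω i) P) {Y : ℝ≥0 → Ω → Fin 3 → ℝ}
    (hrefl : ∀ᵐ ω ∂P, IsReflected θ R (fun t => Z t ω) (fun t => W t ω) (fun t => Y t ω))
    {x : Fin 3 → ℝ} (hx : ∀ᵐ ω ∂P, Z 0 ω = x) {ε δ : ℝ} (hε : 0 < ε) (hδ : 0 < δ)
    (hxε : x ∉ Metric.ball (0 : Fin 3 → ℝ) ε) (hq1 : 0 < x (S.q 1))
    (hsize : 2 * ε * ∑ i, S.u i + 2 * δ ≤ S.c 0 ⬝ᵥ x) :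
    ¬ ∫⁻ ω, hittingTime Z (Metric.ball 0 ε) ω ∂P < ∞ := by
  intro hτ
  have hA : IsOpen (Metric.ball (0 : Fin 3 → ℝ) ε) := Metric.isOpen_ball
  set V : ℝ := 3 * ∑ i, S.entryBound ^ 2 * g i *
    ((∫⁻ ω, hittingTime Z (Metric.ball 0 ε) ω ∂P).toReal + 1) with hV
  have hVnn : 0 ≤ V := by positivity
  set κ : ℝ := δ / 2 / ((V + 1) / (2 * δ) + δ) with hκ
  have hκpos : 0 < κ := by positivity
  -- The level is `1 / (j + 1)` and the mesh `1 / (m + 1)`; with `(m + 1) ^ 2` steps the horizon is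
  -- `m + 1`, which eventually passes any hitting time.
  set E : ℕ → ℕ → Set Ω := fun j m => {ω | -δ < S.gain (1 / ((j : ℝ) + 1)) (Metric.ball 0 ε)
    (fun s => Z s ω) (fun s => W s ω) (1 / ((m : ℝ≥0) + 1)) ((m + 1) * (m + 1))} with hE
  have hEm : ∀ j m, MeasurableSet (E j m) := fun j m =>
    measurableSet_lt measurable_const (S.measurable_gain hZ hc hA hW _ _ _)
  have hEκ : ∀ j m, ENNReal.ofReal κ ≤ P (E j m) := by
    intro j m
    rw [ENNReal.ofReal_le_iff_le_toReal (measure_ne_top _ _)]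
    refine le_measure_of_integral_eq_zero (S.memLp_gain hZ hc hA hW _ _ _)
      (S.measurable_gain hZ hc hA hW _ _ _) (S.integral_gain hZ hc hA hW _ _ _) hVnn hδ
      (S.integral_gain_sq_le hZ hc hA hW hτ _ ?_ _)
    rw [div_le_one (by positivity)]
    exact le_add_self
  have h1 := fun j => le_measure_frequently (hEm j) (hEκ j)
  -- The limsup in `m` is taken first, because the admissible mesh depends on `η` and on the path.
  have h2 := (le_measure_frequently (fun j => (h1 j).1) (fun j => (h1 j).2)).2
  have h3 : P {ω | ∃ᶠ j in Filter.atTop, ω ∈ {ω | ∃ᶠ m in Filter.atTop, ω ∈ E j m}} = 0 := by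
    have hae : ∀ᵐ ω ∂P, ¬ ∃ᶠ j in Filter.atTop, ω ∈ {ω | ∃ᶠ m in Filter.atTop, ω ∈ E j m} := by
      filter_upwards [hrefl, hx, ae_exists_mem_of_hittingTime hZ hc hA hτ] with ω hω hxω hhit
      obtain ⟨η₀, hη₀, H⟩ := S.gain_le hω (hc ω) hε hδ (by rw [hxω]; exact hxε) hhit
        (by rw [hxω]; exact hq1) (by rw [hxω]; exact hsize)
      rw [Filter.not_frequently]
      filter_upwards [tendsto_one_div_add_atTop_nhds_zero_nat.eventually (gt_mem_nhds hη₀)]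
        with j hj
      obtain ⟨h₀, hh₀, T, HT⟩ := H _ (by positivity) hj
      refine Filter.not_frequently.2 ?_
      have hlim : Filter.Tendsto (fun m : ℕ => 1 / ((m : ℝ≥0) + 1)) Filter.atTop (nhds 0) :=
        tendsto_one_div_add_atTop_nhds_zero_nat
      filter_upwards [hlim.eventually (gt_mem_nhds hh₀), Filter.eventually_ge_atTop ⌈T⌉₊]
        with m hm hmT
      have := HT _ (by positivity) hm ((m + 1) * (m + 1)) (by
        have e : (((m + 1) * (m + 1) : ℕ) : ℝ≥0) * (1 / ((m : ℝ≥0) + 1)) = m + 1 := by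
          push_cast; field_simp
        rw [e]
        exact (Nat.ceil_le.1 hmT).trans le_self_add)
      exact not_lt.2 this
    simpa only [ae_iff, not_not] using hae
  rw [h3] at h2
  have : ENNReal.ofReal κ = 0 := le_antisymm h2 zero_le
  rw [ENNReal.ofReal_eq_zero] at this
  linarith

end Spiral

end SRBM

theorem theorem3 {Ω : Type*} [mΩ : MeasurableSpace Ω]
    (θ : Fin 3 → ℝ) (Γ R : Matrix (Fin 3) (Fin 3) ℝ)
    (hΓ : Γ.PosDef) (hR : SRBM.IsCompletelyS R) (hdiag : ∀ i, R i i = 1)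
    (ℱ : Filtration ℝ≥0 mΩ) (Z : ℝ≥0 → Ω → (Fin 3 → ℝ))
    (P : SRBM.orthant 3 → Measure Ω) (hZ : SRBM.IsSRBM θ Γ R ℱ Z P)
    (hC : (θ, R) ∈ SRBM.C) (hβ : 1 ≤ SRBM.β θ R) :
    ¬ SRBM.PositiveRecurrent Z P := by
  intro hpos
  obtain ⟨S⟩ := SRBM.exists_spiral hdiag hC hβ
  let x : SRBM.orthant 3 := ⟨Pi.single (S.q 1) 1, fun i => by
    rw [Pi.single_apply]; split_ifs <;> norm_num⟩
  have := hZ.isProbabilityMeasure x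
  obtain ⟨X, Y, hdec, horth, hBM, hmart, hX0, -, hreg⟩ := hZ.semimartingale x
  have hsum : 0 < ∑ i, S.u i := Finset.sum_pos (fun i _ => S.u_pos i) Finset.univ_nonempty
  have hu := S.u_pos (S.q 1)
  -- From the unit vector of coordinate `q 1`, the initial value of `c 0` is `u (q 1)`. A quarter of
  -- it bounds the terminal term `2 * ε * ∑ i, u i`, and half is `2 * δ`.
  set ε : ℝ := min 1 (S.u (S.q 1) / (8 * ∑ i, S.u i)) with hε
  have hεpos : 0 < ε := by positivity
  refine S.not_lintegral_hittingTime_lt_top (P := P x) hZ.adapted hZ.continuous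
    (fun i => hBM.isScalarBM hΓ.posSemidef hmart i) (Y := Y) (x := x.1) ?_ ?_ hεpos
    (δ := S.u (S.q 1) / 4) (by positivity) ?_ ?_ ?_
    (hpos x (Metric.ball 0 ε) Metric.isOpen_ball (Metric.mem_ball_self hεpos))
  · filter_upwards [hdec, horth, hreg] with ω h1 h2 h3
    refine ⟨fun t => ?_, h2, h3⟩
    rw [sub_add_cancel]; exact h1 t
  · filter_upwards [hdec, hX0, hreg] with ω h1 h2 h3
    have hY : Y 0 ω = 0 := funext fun i => (h3 i).zero
    rw [h1, h2, hY]; simp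
  · rw [mem_ball_zero_iff, not_lt]
    calc ε ≤ 1 := min_le_left _ _
      _ = ‖x.1 (S.q 1)‖ := by simp [x]
      _ ≤ _ := norm_le_pi_norm _ _
  · simp [x]
  · rw [S.c_dotProduct]
    have e1 : S.u ⬝ᵥ x.1 = S.u (S.q 1) := by simp [x]
    have e2 : x.1 (S.q 0) = 0 := by simp [x, S.q_ne]
    rw [e1, e2]
    have h1 : ε * (8 * ∑ i, S.u i) ≤ S.u (S.q 1) := by
      rw [← le_div_iff₀ (by positivity)]; exact min_le_right _ _
    linarith
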